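/- Let $N\ge 3$, let $\Omega\subset\mathbb{R}^N$ be a bounded domain (nonempty, open, connected), and let $h\in L^1(\Omega)$. Let $g:\Omega\times(0,+\infty)\to\mathbb{R}$ be a Carathéodory function (measurable in $x$ for every $s>0$, continuous in $s$ for a.e. $x$) such that (i) there is $g_0\in C((0,+\infty))$ with $|g(x,s)|\le g_0(s)$ for a.e. $x\in\Omega$ and all $s>0$; (ii) for some $\tau>1$ there are $\omega\subset\subset\Omega$ and $s_0\in(0,1)$ with $s\,g(x,s)\ge\tau$ for a.e. $x\in\Omega\setminus\omega$ and all $s\in(0,s_0)$. Consider the problem $$-\Delta u+g(x,u)|\nabla u|^2=h(x)\ \text{ in }\Omega,\qquad u>0\ \text{ in }\Omega,\qquad u=0\ \text{ on }\partial\Omega .\tag{H}$$ A solution to (H) is a function $u\in H^1_{\mathrm{loc}}(\Omega)\cap L^\infty(\Omega)$ such that for every $\omega'\subset\subset\Omega$ there is $c>0$ with $u\ge c$ a.e. in $\omega'$; there is $\gamma>0$ with $u^\gamma\in H^1_0(\Omega)$; and $$\int_\Omega\nabla u\cdot\nabla\phi+\int_\Omega g(x,u)|\nabla u|^2\phi=\int_\Omega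 h\,\phi\qquad\text{for all }\phi\in C^1_c(\Omega).$$ Then every solution $u$ to (H) satisfies $$\int_\Omega\frac{|h(x)|}{u}\,dx=+\infty .$$ -/

import Mathlib

open MeasureTheory Set

/-- Euclidean `N`-dimensional space. -/
abbrev Euc (N : ℕ) : Type := EuclideanSpace ℝ (Fin N)

/-- `ω ⊂⊂ Ω`: the closure of `ω` is a compact subset of `Ω`. -/
def CompactlyContained {N : ℕ} (ω Ω : Set (Euc N)) : Prop :=
  IsCompact (closure ω) ∧ closure ω ⊆ Ω

/-- `φ ∈ C_c^k(Ω)`, where `k` is a natural number or `∞`. -/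
structure IsTestFunction {N : ℕ} (k : ℕ∞) (Ω : Set (Euc N)) (φ : Euc N → ℝ) : Prop where
  contDiff : ContDiff ℝ (k : WithTop ℕ∞) φ
  hasCompactSupport : HasCompactSupport φ
  tsupport_subset : tsupport φ ⊆ Ω

/-- `G` is a weak (distributional) gradient of `u` in the open set `Ω`. It is unique up to
null sets. -/
structure HasWeakGradient {N : ℕ} (Ω : Set (Euc N)) (u : Euc N → ℝ) (G : Euc N → Euc N) :
    Prop where
  locallyIntegrableOn : LocallyIntegrableOn u Ω
  locallyIntegrableOn_grad : LocallyIntegrableOn G Ω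
  integral_eq : ∀ φ : Euc N → ℝ, IsTestFunction (⊤ : ℕ∞) Ω φ → ∀ e : Euc N,
    ∫ x in Ω, u x * fderiv ℝ φ x e = -∫ x in Ω, inner ℝ (G x) e * φ x

/-- `u ∈ H¹_loc(Ω)`, with weak gradient `G`. -/
structure MemH1loc {N : ℕ} (Ω : Set (Euc N)) (u : Euc N → ℝ) (G : Euc N → Euc N) : Prop where
  hasWeakGradient : HasWeakGradient Ω u G
  memLp : ∀ ω, CompactlyContained ω Ω → MemLp u 2 (volume.restrict ω)
  memLp_grad : ∀ ω, CompactlyContained ω Ω → MemLp G 2 (volume.restrict ω)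

/-- `w ∈ H¹₀(Ω)`: `w` belongs to `H¹(Ω)` and is a limit, in the `H¹` norm, of functions of
class `C_c^∞(Ω)`. -/
def MemH10 {N : ℕ} (Ω : Set (Euc N)) (w : Euc N → ℝ) : Prop :=
  ∃ G : Euc N → Euc N, HasWeakGradient Ω w G ∧
    MemLp w 2 (volume.restrict Ω) ∧ MemLp G 2 (volume.restrict Ω) ∧
    ∀ ε : ENNReal, 0 < ε → ∃ φ : Euc N → ℝ, IsTestFunction (⊤ : ℕ∞) Ω φ ∧
      eLpNorm (fun x => w x - φ x) 2 (volume.restrict Ω) < ε ∧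
      eLpNorm (fun x => G x - gradient φ x) 2 (volume.restrict Ω) < ε

/-- `g : Ω × (0,+∞) → ℝ` is a Carathéodory function: (Lebesgue) measurable in `x` for every
`s > 0`, and continuous in `s > 0` for a.e. `x`. -/
structure IsCaratheodory {N : ℕ} (Ω : Set (Euc N)) (g : Euc N → ℝ → ℝ) : Prop where
  aemeasurable : ∀ s : ℝ, 0 < s → AEMeasurable (fun x => g x s) (volume.restrict Ω)
  continuousOn : ∀ᵐ x ∂(volume.restrict Ω), ContinuousOn (g x) (Ioi 0)

/-- There is `g₀ ∈ C((0,+∞))` with `|g(x,s)| ≤ g₀(s)` for a.e. `x ∈ Ω` and all `s > 0`. -/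
def LocallyControlled {N : ℕ} (Ω : Set (Euc N)) (g : Euc N → ℝ → ℝ) : Prop :=
  ∃ g₀ : ℝ → ℝ, ContinuousOn g₀ (Ioi 0) ∧
    ∀ᵐ x ∂(volume.restrict Ω), ∀ s : ℝ, 0 < s → |g x s| ≤ g₀ s

/-- There are `ω ⊂⊂ Ω` and `s₀ ∈ (0,1)` with `s g(x,s) ≥ τ` for a.e. `x ∈ Ω \ ω` and all
`s ∈ (0,s₀)`. -/
def LargeNearBoundary {N : ℕ} (Ω : Set (Euc N)) (g : Euc N → ℝ → ℝ) (τ : ℝ) : Prop :=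
  ∃ ω : Set (Euc N), CompactlyContained ω Ω ∧ ∃ s₀ ∈ Ioo (0 : ℝ) 1,
    ∀ᵐ x ∂(volume.restrict Ω), x ∉ ω → ∀ s ∈ Ioo (0 : ℝ) s₀, τ ≤ s * g x s

/-- `u` is a solution to `-Δu + g(x,u)|∇u|² = h` in `Ω`, `u > 0` in `Ω`, `u = 0` on `∂Ω`:
`u ∈ H¹_loc(Ω) ∩ L^∞(Ω)` is bounded away from zero on every `ω ⊂⊂ Ω`, some positive power of `u`
is in `H¹₀(Ω)`, and the equation holds weakly against every `φ ∈ C_c¹(Ω)`. -/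
def IsSolution {N : ℕ} (Ω : Set (Euc N)) (g : Euc N → ℝ → ℝ) (h : Euc N → ℝ)
    (u : Euc N → ℝ) : Prop :=
  MemLp u ⊤ (volume.restrict Ω) ∧
  (∀ ω, CompactlyContained ω Ω → ∃ c : ℝ, 0 < c ∧ ∀ᵐ x ∂(volume.restrict ω), c ≤ u x) ∧
  (∃ γ : ℝ, 0 < γ ∧ MemH10 Ω (fun x => u x ^ γ)) ∧
  ∃ G : Euc N → Euc N, MemH1loc Ω u G ∧
    ∀ φ : Euc N → ℝ, IsTestFunction 1 Ω φ →
      (∫ x in Ω, inner ℝ (G x) (gradient φ x)) + ∫ x in Ω, g x (u x) * ‖G x‖ ^ 2 * φ x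
        = ∫ x in Ω, h x * φ x

open Filter Topology
open scoped Convolution

/-! Suppose `∫ |h| / u` is finite. The idea is to test the equation with roughly `1/u`.
Differentiating `1/u` costs `-|∇u|² / u²`, while the lower-order term returns at least `τ |∇u|² /
u²` near the boundary, so a margin `(τ - 1) |∇u|² / u²` survives and `log u` has finite Dirichlet
energy. But `log u` should tend to `-∞` at the boundary. The truncation `Θ(log u / m + 2)`, with `Θ`
the smooth transition from 0 to 1, vanishes where `u ≤ e^{-2m}`, equals 1 where `u ≥ e^{-m}`, and
has energy `O(1/m²)`. As `m → ∞` the Poincaré inequality forces any ball inside `Ω` to have measure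
zero, a contradiction.

The actual test function is `F(u) η²` with `F(s) = Θ(s/ε - 1) e^{Λs} / s`. The exponential pays for
the region where `u` is not small and `g` is only bounded (`exists_absorbing_constant`). The factor
`Θ(s/ε - 1)` removes `{u ≤ ε}`, and `η` is a compactly supported cutoff. The boundary condition
enters only through `exists_cutoff`: since `u^γ ∈ H¹₀(Ω)`, one can take `η = 1` on `{u ≥ ε}` up to
small measure, with small gradient energy there. This gives `exists_energy_bound`, uniform in `ε`.

Neither `F(u) η²` nor the truncated logarithm times `η` need be of class `C¹`. Mollifying `u` near
the support of `η`, where `u` is bounded away from 0, gives `exists_testFunction_approx`, from which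
the weak formulation (`weak_formulation_comp_mul`) and the Poincaré inequality
(`exists_poincare_comp_mul`) extend to these functions. -/

/-! ### `L²` inequalities and mollification. -/

theorem sq_eLpNorm_two {α F : Type*} [MeasurableSpace α] [NormedAddCommGroup F] {μ : Measure α}
    (f : α → F) : eLpNorm f 2 μ ^ 2 = ∫⁻ x, ‖f x‖ₑ ^ 2 ∂μ := by
  have h := eLpNorm_nnreal_pow_eq_lintegral (f := f) (μ := μ) (p := 2) two_ne_zero
  simpa only [NNReal.coe_ofNat, ENNReal.coe_ofNat, ENNReal.rpow_ofNat] using h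

theorem sq_lintegral_mul_le {α : Type*} [MeasurableSpace α] {μ : Measure α} {a b : α → ENNReal}
    (ha : AEMeasurable a μ) (hb : AEMeasurable b μ) :
    (∫⁻ x, a x * b x ∂μ) ^ 2 ≤ (∫⁻ x, a x ^ 2 ∂μ) * ∫⁻ x, b x ^ 2 ∂μ := by
  have h := ENNReal.lintegral_mul_le_Lp_mul_Lq μ (p := 2) (q := 2)
    Real.HolderConjugate.two_two ha hb
  have h2 := pow_le_pow_left' h 2
  rw [mul_pow] at h2
  have h3 : ∀ c : ENNReal, (c ^ (1 / 2 : ℝ)) ^ 2 = c := fun c ↦ by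
    rw [← ENNReal.rpow_natCast, ← ENNReal.rpow_mul]
    norm_num
  simp only [h3, ENNReal.rpow_two] at h2
  exact h2

theorem enorm_add_sq_le {F : Type*} [NormedAddCommGroup F] (a b : F) :
    ‖a + b‖ₑ ^ 2 ≤ 2 * ‖a‖ₑ ^ 2 + 2 * ‖b‖ₑ ^ 2 := by
  have h := ENNReal.rpow_add_le_mul_rpow_add_rpow ‖a‖ₑ ‖b‖ₑ (p := 2) (by norm_num)
  rw [show (2 : ℝ) - 1 = 1 by norm_num, ENNReal.rpow_one] at h
  norm_cast at h
  rw [← mul_add]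
  exact (pow_le_pow_left' (enorm_add_le a b) 2).trans h

/-- Jensen's inequality for a probability density, obtained from Hölder by splitting `ρ ‖f‖` as
`ρ^{1/2} (ρ ‖f‖²)^{1/2}`. -/
theorem sq_enorm_integral_smul_le {α F : Type*} [MeasurableSpace α] [NormedAddCommGroup F]
    [NormedSpace ℝ F] {μ : Measure α} {ρ : α → ℝ} {f : α → F} (hρ : AEMeasurable ρ μ)
    (hρ_nonneg : ∀ x, 0 ≤ ρ x) (hρ_one : ∫⁻ x, ENNReal.ofReal (ρ x) ∂μ = 1)
    (hf : AEStronglyMeasurable f μ) :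
    ‖∫ x, ρ x • f x ∂μ‖ₑ ^ 2 ≤ ∫⁻ x, ENNReal.ofReal (ρ x) * ‖f x‖ₑ ^ 2 ∂μ := by
  have h1 : ‖∫ x, ρ x • f x ∂μ‖ₑ ≤ ∫⁻ x, ENNReal.ofReal (ρ x) * ‖f x‖ₑ ∂μ := by
    refine (enorm_integral_le_lintegral_enorm _).trans_eq (lintegral_congr fun x ↦ ?_)
    rw [enorm_smul, Real.enorm_of_nonneg (hρ_nonneg x)]
  have h2 := ENNReal.lintegral_mul_norm_pow_le (μ := μ) (p := 1 / 2) (q := 1 / 2)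
    (f := fun x ↦ ENNReal.ofReal (ρ x)) (g := fun x ↦ ENNReal.ofReal (ρ x) * ‖f x‖ₑ ^ 2)
    hρ.ennreal_ofReal (hρ.ennreal_ofReal.mul (hf.enorm.pow_const 2)) (by norm_num) (by norm_num)
    (by norm_num)
  have h3 : ∀ x, ENNReal.ofReal (ρ x) ^ (1 / 2 : ℝ) *
      (ENNReal.ofReal (ρ x) * ‖f x‖ₑ ^ 2) ^ (1 / 2 : ℝ) = ENNReal.ofReal (ρ x) * ‖f x‖ₑ := by
    intro x
    rw [ENNReal.mul_rpow_of_nonneg _ _ (by norm_num), ← mul_assoc,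
      ← ENNReal.rpow_add_of_nonneg _ _ (by norm_num) (by norm_num), ← ENNReal.rpow_natCast,
      ← ENNReal.rpow_mul]
    norm_num
  simp only [h3, hρ_one, ENNReal.one_rpow, one_mul] at h2
  have h4 := pow_le_pow_left' (h1.trans h2) 2
  rwa [← ENNReal.rpow_natCast (_ ^ (1 / 2 : ℝ)), ← ENNReal.rpow_mul, show (1 / 2 : ℝ) * (2 : ℕ) = 1
    by norm_num, ENNReal.rpow_one] at h4

theorem tendsto_lintegral_translate_sub {N : ℕ} {F : Type*} [NormedAddCommGroup F]
    {f : Euc N → F} (hf : MemLp f 2 volume) :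
    Tendsto (fun t : Euc N ↦ ∫⁻ x, ‖f (x - t) - f x‖ₑ ^ 2) (𝓝 0) (𝓝 0) := by
  have : Fact ((1 : ENNReal) ≤ 2) := ⟨by norm_num⟩
  -- Currying makes translation by `t` depend continuously on `t` in the compact-open topology,
  -- which is the continuity that composition on `Lp` requires.
  let g : C(Euc N, C(Euc N, Euc N)) :=
    (ContinuousMap.mk (fun a : Euc N × Euc N ↦ a.2 - a.1) (by fun_prop)).curry
  have hgm : ∀ t, MeasurePreserving (g t) volume volume :=
    fun t ↦ measurePreserving_sub_right volume t
  have h := Filter.Tendsto.compMeasurePreservingLp (μ := (volume : Measure (Euc N)))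
    (tendsto_const_nhds (x := hf.toLp f) (f := 𝓝 (0 : Euc N))) (g.continuous.tendsto 0) hgm (hgm 0)
    (by norm_num)
  rw [tendsto_iff_edist_tendsto_0] at h
  have h0 : Lp.compMeasurePreserving (g 0) (hgm 0) (hf.toLp f) = hf.toLp f := by
    rw [Lp.toLp_compMeasurePreserving]
    congr 1
    ext x
    simp [g]
  have h' : ∀ t, edist (Lp.compMeasurePreserving (g t) (hgm t) (hf.toLp f))
      (Lp.compMeasurePreserving (g 0) (hgm 0) (hf.toLp f)) ^ 2
      = ∫⁻ x, ‖f (x - t) - f x‖ₑ ^ 2 := by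
    intro t
    rw [h0, Lp.toLp_compMeasurePreserving, Lp.edist_toLp_toLp, sq_eLpNorm_two]
    rfl
  simp_rw [← h']
  simpa using ENNReal.Tendsto.pow (n := 2) h

/-- Mollifications of an `L²` function converge to it in `L²`. -/
theorem tendsto_lintegral_mollify_sub {N : ℕ} {F : Type*} [NormedAddCommGroup F] [NormedSpace ℝ F]
    [CompleteSpace F] {f : Euc N → F} (hf : MemLp f 2 volume) {ρ : ℕ → ContDiffBump (0 : Euc N)}
    (hρ : Tendsto (fun k ↦ (ρ k).rOut) atTop (𝓝 0)) :
    Tendsto (fun k ↦ ∫⁻ x, ‖((ρ k).normed volume ⋆[ContinuousLinearMap.lsmul ℝ ℝ, volume] f) x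
      - f x‖ₑ ^ 2) atTop (𝓝 0) := by
  have hloc : LocallyIntegrable f volume := hf.locallyIntegrable (by norm_num)
  have hrep : ∀ k x, ((ρ k).normed volume ⋆[ContinuousLinearMap.lsmul ℝ ℝ, volume] f) x - f x
      = ∫ t, (ρ k).normed volume t • (f (x - t) - f x) := by
    intro k x
    have h1 : Integrable (fun t ↦ (ρ k).normed volume t • f (x - t)) :=
      (ρ k).hasCompactSupport_normed.convolutionExists_left (ContinuousLinearMap.lsmul ℝ ℝ)
        (ρ k).continuous_normed hloc x
    simp only [smul_sub]
    rw [integral_sub h1 ((ρ k).integrable_normed.smul_const _), integral_smul_const,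
      (ρ k).integral_normed, one_smul]
    rfl
  have hone : ∀ k, ∫⁻ t, ENNReal.ofReal ((ρ k).normed volume t) = 1 := by
    intro k
    rw [← ofReal_integral_eq_lintegral_ofReal (ρ k).integrable_normed
      (Eventually.of_forall (ρ k).nonneg_normed), (ρ k).integral_normed, ENNReal.ofReal_one]
  have hsub : AEStronglyMeasurable (fun p : Euc N × Euc N ↦ f (p.1 - p.2) - f p.1)
      (volume.prod volume) :=
    (hf.1.comp_quasiMeasurePreserving
      (quasiMeasurePreserving_sub_of_right_invariant volume volume)).sub hf.1.comp_fst
  rw [ENNReal.tendsto_nhds_zero]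
  intro ε hε
  have hev := ENNReal.tendsto_nhds_zero.1 (tendsto_lintegral_translate_sub hf) ε hε
  obtain ⟨r, hr, hball⟩ := Metric.eventually_nhds_iff_ball.1 hev
  filter_upwards [hρ.eventually (gt_mem_nhds hr)] with k hk
  calc ∫⁻ x, ‖((ρ k).normed volume ⋆[ContinuousLinearMap.lsmul ℝ ℝ, volume] f) x - f x‖ₑ ^ 2
      ≤ ∫⁻ x, ∫⁻ t, ENNReal.ofReal ((ρ k).normed volume t) * ‖f (x - t) - f x‖ₑ ^ 2 := by
        refine lintegral_mono_ae ?_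
        filter_upwards [hsub.prodMk_left] with x hx
        rw [hrep]
        exact sq_enorm_integral_smul_le (ρ k).continuous_normed.aemeasurable (ρ k).nonneg_normed
          (hone k) hx
    _ = ∫⁻ t, ∫⁻ x, ENNReal.ofReal ((ρ k).normed volume t) * ‖f (x - t) - f x‖ₑ ^ 2 := by
        refine lintegral_lintegral_swap ?_
        exact ((ρ k).continuous_normed.measurable.comp measurable_snd).ennreal_ofReal.aemeasurable.mul
          (hsub.enorm.pow_const 2)
    _ = ∫⁻ t, ENNReal.ofReal ((ρ k).normed volume t) * ∫⁻ x, ‖f (x - t) - f x‖ₑ ^ 2 := by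
        refine lintegral_congr fun t ↦ lintegral_const_mul' _ _ ENNReal.ofReal_ne_top
    _ ≤ ∫⁻ t, ENNReal.ofReal ((ρ k).normed volume t) * ε := by
        refine lintegral_mono fun t ↦ ?_
        by_cases ht : t ∈ Metric.ball (0 : Euc N) (ρ k).rOut
        · dsimp only
          gcongr
          exact hball t (Metric.ball_subset_ball hk.le ht)
        · rw [← (ρ k).support_normed_eq (μ := volume), Function.notMem_support] at ht
          simp [ht]
    _ = ε := by
        rw [lintegral_mul_const _ (ρ k).continuous_normed.measurable.ennreal_ofReal, hone, one_mul]

/-- The gradient of a mollification is the mollification of the weak gradient. -/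
theorem gradient_mollify {N : ℕ} {Ω U : Set (Euc N)} (hU : IsCompact U) (hUΩ : U ⊆ Ω)
    {u : Euc N → ℝ} {G : Euc N → Euc N} (hG : HasWeakGradient Ω u G)
    (ρ : ContDiffBump (0 : Euc N)) {x : Euc N} (hx : Metric.closedBall x ρ.rOut ⊆ U) :
    HasGradientAt (ρ.normed volume ⋆[ContinuousLinearMap.lsmul ℝ ℝ, volume] U.indicator u)
      ((ρ.normed volume ⋆[ContinuousLinearMap.lsmul ℝ ℝ, volume] U.indicator G) x) x := by
  have hu : Integrable (U.indicator u) :=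
    (hG.locallyIntegrableOn.integrableOn_compact_subset hUΩ hU).integrable_indicator
      hU.measurableSet
  have hG' : Integrable (U.indicator G) :=
    (hG.locallyIntegrableOn_grad.integrableOn_compact_subset hUΩ hU).integrable_indicator
      hU.measurableSet
  have hρ : ContDiff ℝ 1 (ρ.normed volume) := ρ.contDiff_normed
  have h1 := ρ.hasCompactSupport_normed.hasFDerivAt_convolution_left
    (ContinuousLinearMap.lsmul ℝ ℝ) hρ hu.locallyIntegrable x
  have hexu := ((ρ.hasCompactSupport_normed (μ := volume)).fderiv ℝ).convolutionExists_left
    (ContinuousLinearMap.precompL (Euc N) (ContinuousLinearMap.lsmul ℝ ℝ))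
    (hρ.continuous_fderiv one_ne_zero) hu.locallyIntegrable x
  have hexG := (ρ.hasCompactSupport_normed (μ := volume)).convolutionExists_left
    (ContinuousLinearMap.lsmul ℝ ℝ) ρ.continuous_normed hG'.locallyIntegrable x
  rw [hasGradientAt_iff_hasFDerivAt]
  suffices h2 : InnerProductSpace.toDual ℝ (Euc N)
      ((ρ.normed volume ⋆[ContinuousLinearMap.lsmul ℝ ℝ, volume] U.indicator G) x) =
      (fderiv ℝ (ρ.normed volume) ⋆[ContinuousLinearMap.precompL (Euc N)
        (ContinuousLinearMap.lsmul ℝ ℝ), volume] U.indicator u) x by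
    rw [h2]
    exact h1
  refine ContinuousLinearMap.ext fun e : Euc N ↦ ?_
  -- The weak gradient is tested against the reflected and translated kernel; the sign from the
  -- reflection cancels the one in the integration by parts.
  set φ : Euc N → ℝ := fun t ↦ ρ.normed volume (x - t) with hφdef
  have hφ_smooth : ContDiff ℝ ((⊤ : ℕ∞) : WithTop ℕ∞) φ :=
    (ρ.contDiff_normed (n := ⊤)).comp (contDiff_const.sub contDiff_id)
  have hφ_supp : Function.support φ ⊆ Metric.closedBall x ρ.rOut := by
    intro t ht
    have : x - t ∈ Function.support (ρ.normed volume) := ht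
    rw [ρ.support_normed_eq, mem_ball_zero_iff, ← dist_eq_norm, dist_comm] at this
    exact Metric.mem_closedBall.2 this.le
  have hφ_tsupp : tsupport φ ⊆ Metric.closedBall x ρ.rOut :=
    closure_minimal hφ_supp Metric.isClosed_closedBall
  have hφ : IsTestFunction ⊤ Ω φ :=
    ⟨hφ_smooth, HasCompactSupport.of_support_subset_isCompact (isCompact_closedBall _ _) hφ_supp,
      hφ_tsupp.trans (hx.trans hUΩ)⟩
  have hφ_deriv : ∀ t, fderiv ℝ φ t e = -fderiv ℝ (ρ.normed volume) (x - t) e := by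
    intro t
    have h2 : HasFDerivAt φ ((fderiv ℝ (ρ.normed volume) (x - t)).comp
        (-ContinuousLinearMap.id ℝ (Euc N))) t :=
      ((hρ.differentiable one_ne_zero) (x - t)).hasFDerivAt.comp t ((hasFDerivAt_id t).const_sub x)
    rw [h2.fderiv]
    simp
  have key := hG.integral_eq φ hφ e
  have hφ_zero : ∀ t, t ∉ U → φ t = 0 := fun t ht ↦ by
    by_contra h0
    exact ht (hx (hφ_supp h0))
  have hφ_deriv_zero : ∀ t, t ∉ U → fderiv ℝ φ t = 0 := fun t ht ↦ by
    by_contra h0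
    exact ht (hx (hφ_tsupp (support_fderiv_subset ℝ h0)))
  rw [setIntegral_eq_integral_of_forall_compl_eq_zero
      (fun t ht ↦ by rw [hφ_deriv_zero t (fun h ↦ ht (hUΩ h))]; simp),
    setIntegral_eq_integral_of_forall_compl_eq_zero
      (fun t ht ↦ by rw [hφ_zero t (fun h ↦ ht (hUΩ h))]; simp)] at key
  have hL : InnerProductSpace.toDual ℝ (Euc N)
      ((ρ.normed volume ⋆[ContinuousLinearMap.lsmul ℝ ℝ, volume] U.indicator G) x) e
      = ∫ t, inner ℝ (G t) e * φ t := by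
    rw [InnerProductSpace.toDual_apply_apply, convolution_eq_swap, real_inner_comm,
      ← integral_inner hexG.integrable_swap]
    refine integral_congr_ae (Eventually.of_forall fun t ↦ ?_)
    by_cases ht : t ∈ U
    · simp [ht, inner_smul_right, hφdef, real_inner_comm, mul_comm]
    · simp [ht, hφ_zero t ht]
  have hR : (fderiv ℝ (ρ.normed volume) ⋆[ContinuousLinearMap.precompL (Euc N)
      (ContinuousLinearMap.lsmul ℝ ℝ), volume] U.indicator u) x e
      = -∫ t, u t * fderiv ℝ φ t e := by
    rw [convolution_eq_swap, ContinuousLinearMap.integral_apply hexu.integrable_swap,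
      ← integral_neg]
    refine integral_congr_ae (Eventually.of_forall fun t ↦ ?_)
    by_cases ht : t ∈ U
    · simp [ht, hφ_deriv, ContinuousLinearMap.precompL_apply, mul_comm]
    · simp [ht, hφ_deriv_zero t ht]
  rw [hL, hR, key, neg_neg]

/-- An average of values in `[c, M]` stays there. With `c > 0`, this keeps mollifications of `u` in
a compact part of `(0, ∞)`, where `F` and its derivative are bounded. -/
theorem mollify_mem_Icc {N : ℕ} {U : Set (Euc N)} (hU : MeasurableSet U) {u : Euc N → ℝ}
    {c M : ℝ} (hu : IntegrableOn u U) (hcM : ∀ᵐ x ∂(volume.restrict U), u x ∈ Icc c M)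
    (ρ : ContDiffBump (0 : Euc N)) {x : Euc N} (hx : Metric.closedBall x ρ.rOut ⊆ U) :
    (ρ.normed volume ⋆[ContinuousLinearMap.lsmul ℝ ℝ, volume] U.indicator u) x ∈ Icc c M := by
  have hex := ((ρ.hasCompactSupport_normed (μ := volume)).convolutionExists_left
    (ContinuousLinearMap.lsmul ℝ ℝ) ρ.continuous_normed
    (hu.integrable_indicator hU).locallyIntegrable x).integrable_swap
  have hone : ∫ t, ρ.normed volume (x - t) = 1 := by
    rw [integral_sub_left_eq_self (fun t ↦ ρ.normed volume t) volume x, ρ.integral_normed]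
  have hint : Integrable (fun t ↦ ρ.normed volume (x - t)) :=
    ρ.integrable_normed.comp_sub_left x
  have hzero : ∀ t, t ∉ U → ρ.normed volume (x - t) = 0 := by
    intro t ht
    by_contra h0
    have h1 : x - t ∈ Function.support (ρ.normed volume) := h0
    rw [ρ.support_normed_eq, mem_ball_zero_iff, ← dist_eq_norm, dist_comm] at h1
    exact ht (hx (Metric.mem_closedBall.2 h1.le))
  have hae := (ae_restrict_iff' hU).1 hcM
  rw [convolution_eq_swap]
  constructor
  · calc c = ∫ t, ρ.normed volume (x - t) * c := by rw [integral_mul_const, hone, one_mul]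
      _ ≤ _ := by
        refine integral_mono_ae (hint.mul_const c) hex ?_
        filter_upwards [hae] with t ht
        by_cases htU : t ∈ U
        · simpa [htU] using mul_le_mul_of_nonneg_left (ht htU).1 (ρ.nonneg_normed (x - t))
        · simp [htU, hzero t htU]
  · calc _ ≤ ∫ t, ρ.normed volume (x - t) * M := by
          refine integral_mono_ae hex (hint.mul_const M) ?_
          filter_upwards [hae] with t ht
          by_cases htU : t ∈ U
          · simpa [htU] using mul_le_mul_of_nonneg_left (ht htU).2 (ρ.nonneg_normed (x - t))
          · simp [htU, hzero t htU]
      _ = M := by rw [integral_mul_const, hone, one_mul]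

/-! ### Approximation of `F(u) η` by test functions. -/

theorem aemeasurable_comp_of_continuousOn_Ioi {α : Type*} [MeasurableSpace α] {μ : Measure α}
    {F : ℝ → ℝ} (hF : ContinuousOn F (Ioi 0)) {u : α → ℝ} (hu : AEMeasurable u μ)
    (hpos : ∀ᵐ x ∂μ, 0 < u x) : AEMeasurable (fun x ↦ F (u x)) μ := by
  classical
  have h1 : Measurable ((Ioi 0).piecewise F fun _ ↦ 0) :=
    hF.measurable_piecewise continuousOn_const measurableSet_Ioi
  refine (h1.comp_aemeasurable hu).congr ?_
  filter_upwards [hpos] with x hx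
  simp [Set.piecewise, hx]

theorem HasGradientAt.comp_mul {N : ℕ} {F : ℝ → ℝ} {F' : ℝ} {w η : Euc N → ℝ} {x p q : Euc N}
    (hF : HasDerivAt F F' (w x)) (hw : HasGradientAt w p x) (hη : HasGradientAt η q x) :
    HasGradientAt (fun y ↦ F (w y) * η y) (F (w x) • q + (F' * η x) • p) x := by
  rw [hasGradientAt_iff_hasFDerivAt] at *
  have h := (hF.comp_hasFDerivAt x hw).mul hη
  convert! h using 1
  ext e
  simp
  ring

theorem lintegral_eq_setLIntegral_of_forall_notMem {α : Type*} [MeasurableSpace α] {μ : Measure α}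
    {s : Set α} (hs : MeasurableSet s) {f : α → ENNReal} (hf : ∀ x, x ∉ s → f x = 0) :
    ∫⁻ x, f x ∂μ = ∫⁻ x in s, f x ∂μ := by
  rw [← lintegral_indicator hs]
  refine lintegral_congr fun x ↦ ?_
  by_cases hx : x ∈ s <;> simp [hx, hf]

set_option maxHeartbeats 400000 in
/-- If `F` is `C¹` on `(0, ∞)` and `η` is a test function, then `F(u) η` is a limit of `C_c¹`
functions, with convergence of the gradients in `L²`. -/
theorem exists_testFunction_approx {N : ℕ} {Ω : Set (Euc N)} (hΩ : IsOpen Ω) {u : Euc N → ℝ}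
    {G : Euc N → Euc N} (hG : MemH1loc Ω u G) {M : ℝ}
    (hM : ∀ᵐ x ∂(volume.restrict Ω), u x ≤ M)
    (hpos : ∀ ω, CompactlyContained ω Ω → ∃ c : ℝ, 0 < c ∧ ∀ᵐ x ∂(volume.restrict ω), c ≤ u x)
    {F : ℝ → ℝ} (hF : ContDiffOn ℝ 1 F (Ioi 0)) {η : Euc N → ℝ} (hη : IsTestFunction ⊤ Ω η) :
    ∃ φ : ℕ → Euc N → ℝ, (∀ k, IsTestFunction 1 Ω (φ k)) ∧
      (∀ k x, x ∉ tsupport η → φ k x = 0) ∧ (∃ C, ∀ k x, |φ k x| ≤ C) ∧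
      (∀ᵐ x ∂(volume.restrict Ω), Tendsto (fun k ↦ φ k x) atTop (𝓝 (F (u x) * η x))) ∧
      Tendsto (fun k ↦ ∫⁻ x in Ω, ‖gradient (φ k) x -
        (F (u x) • gradient η x + (deriv F (u x) * η x) • G x)‖ₑ ^ 2) atTop (𝓝 0) := by
  set K := tsupport η with hK
  have hKc : IsCompact K := hη.hasCompactSupport
  have hη_diff : ∀ x, HasGradientAt η (gradient η x) x := fun x ↦
    ((hη.contDiff.differentiable (by simp)) x).hasGradientAt
  have hη_cont : Continuous (gradient η) :=
    (LinearIsometryEquiv.continuous _).comp (hη.contDiff.continuous_fderiv (by simp))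
  have hη_grad_zero : ∀ x, x ∉ K → gradient η x = 0 := fun x hx ↦ by
    have h0 : fderiv ℝ η x = 0 := by
      by_contra h0
      exact hx (support_fderiv_subset ℝ h0)
    simp [gradient, h0]
  have hη_zero : ∀ x, x ∉ K → η x = 0 := fun x hx ↦ image_eq_zero_of_notMem_tsupport hx
  obtain ⟨δ, hδ, hδΩ⟩ := hKc.exists_cthickening_subset_open hΩ hη.tsupport_subset
  set U := Metric.cthickening δ K with hU
  have hUc : IsCompact U := hKc.cthickening
  have hUm : MeasurableSet U := hUc.measurableSet
  have hKm : MeasurableSet K := hKc.measurableSet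
  have hKU : K ⊆ U := Metric.self_subset_cthickening K
  have hUcc : CompactlyContained U Ω := by
    refine ⟨?_, ?_⟩ <;> rw [hUc.isClosed.closure_eq] <;> assumption
  obtain ⟨c, hc, hcu⟩ := hpos U hUcc
  have hMU : ∀ᵐ x ∂(volume.restrict U), u x ≤ M := ae_restrict_of_ae_restrict_of_subset hδΩ hM
  have hcM : ∀ᵐ x ∂(volume.restrict U), u x ∈ Icc c M := by
    filter_upwards [hcu, hMU] with x h1 h2 using ⟨h1, h2⟩
  have hcMK : ∀ᵐ x ∂(volume.restrict K), u x ∈ Icc c M :=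
    ae_restrict_of_ae_restrict_of_subset hKU hcM
  -- Outer radii at most `δ` keep balls centred in `K` inside `U`; the fixed ratio 2 between the
  -- radii is what almost everywhere convergence of the mollifications requires.
  let ρ : ℕ → ContDiffBump (0 : Euc N) := fun k ↦
    ⟨δ / (k + 1) / 2, δ / (k + 1), by positivity, half_lt_self (by positivity)⟩
  have hρ_le : ∀ k, (ρ k).rOut ≤ δ := fun k ↦ div_le_self hδ.le (by simp)
  have hρ : Tendsto (fun k ↦ (ρ k).rOut) atTop (𝓝 0) :=
    tendsto_const_div_atTop_nhds_zero_nat δ |>.comp (tendsto_add_atTop_nat 1) |>.congr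
      fun k ↦ by simp [ρ]
  have hball : ∀ k, ∀ x ∈ K, Metric.closedBall x (ρ k).rOut ⊆ U := fun k x hx ↦
    (Metric.closedBall_subset_closedBall (hρ_le k)).trans
      (Metric.closedBall_subset_cthickening hx δ)
  have huU : IntegrableOn u U :=
    hG.hasWeakGradient.locallyIntegrableOn.integrableOn_compact_subset hδΩ hUc
  have hu : Integrable (U.indicator u) := huU.integrable_indicator hUm
  have hG2 : MemLp (U.indicator G) 2 := (memLp_indicator_iff_restrict hUm).2 (hG.memLp_grad U hUcc)
  set w : ℕ → Euc N → ℝ := fun k ↦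
    (ρ k).normed volume ⋆[ContinuousLinearMap.lsmul ℝ ℝ, volume] U.indicator u with hw
  set H : ℕ → Euc N → Euc N := fun k ↦
    (ρ k).normed volume ⋆[ContinuousLinearMap.lsmul ℝ ℝ, volume] U.indicator G with hH
  have hw_smooth : ∀ k, ContDiff ℝ 1 (w k) := fun k ↦
    (ρ k).hasCompactSupport_normed.contDiff_convolution_left (n := 1) _ (ρ k).contDiff_normed
      hu.locallyIntegrable
  have hw_mem : ∀ k, ∀ x ∈ K, w k x ∈ Icc c M := fun k x hx ↦
    mollify_mem_Icc hUm huU hcM (ρ k) (hball k x hx)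
  have hw_grad : ∀ k, ∀ x ∈ K, HasGradientAt (w k) (H k x) x := fun k x hx ↦
    gradient_mollify hUc hδΩ hG.hasWeakGradient (ρ k) (hball k x hx)
  have hw_lim : ∀ᵐ x ∂(volume.restrict K), Tendsto (fun k ↦ w k x) atTop (𝓝 (u x)) := by
    have h1 := ContDiffBump.ae_convolution_tendsto_right_of_locallyIntegrable (μ := volume) (K := 2)
      hρ (Eventually.of_forall fun k ↦ by simp only [ρ]; linarith) hu.locallyIntegrable
    filter_upwards [ae_restrict_of_ae h1, ae_restrict_mem hKm] with x hx hxK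
    simpa [indicator_of_mem (hKU hxK)] using hx
  have hH_lim : Tendsto (fun k ↦ ∫⁻ x in K, ‖H k x - G x‖ₑ ^ 2) atTop (𝓝 0) := by
    refine tendsto_of_tendsto_of_tendsto_of_le_of_le tendsto_const_nhds
      (tendsto_lintegral_mollify_sub hG2 hρ) (fun _ ↦ zero_le) fun k ↦ ?_
    refine le_trans (le_of_eq ?_) (setLIntegral_le_lintegral K _)
    exact setLIntegral_congr_fun hKm fun x hx ↦ by simp [hH, indicator_of_mem (hKU hx)]
  have hIcc : Icc c M ⊆ Ioi 0 := fun s hs ↦ hc.trans_le hs.1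
  have hF_deriv : ∀ s, 0 < s → HasDerivAt F (deriv F s) s := fun s hs ↦
    ((hF.differentiableOn one_ne_zero).differentiableAt (Ioi_mem_nhds hs)).hasDerivAt
  have hF'_cont : ContinuousOn (deriv F) (Ioi 0) := hF.continuousOn_deriv_of_isOpen isOpen_Ioi le_rfl
  obtain ⟨A, hA⟩ := isCompact_Icc.exists_bound_of_continuousOn (hF.continuousOn.mono hIcc)
  obtain ⟨B, hB⟩ := isCompact_Icc.exists_bound_of_continuousOn (hF'_cont.mono hIcc)
  obtain ⟨E, hE⟩ := hη.hasCompactSupport.exists_bound_of_continuous hη.contDiff.continuous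
  obtain ⟨E', hE'⟩ := hKc.exists_bound_of_continuousOn hη_cont.continuousOn
  have hE0 : 0 ≤ E := (norm_nonneg _).trans (hE 0)
  have hgrad : ∀ k, ∀ x ∈ K, gradient (fun y ↦ F (w k y) * η y) x =
      F (w k x) • gradient η x + (deriv F (w k x) * η x) • H k x := fun k x hx ↦
    (HasGradientAt.comp_mul (hF_deriv _ (hIcc (hw_mem k x hx))) (hw_grad k x hx)
      (hη_diff x)).gradient
  have hsupp : ∀ k, tsupport (fun y ↦ F (w k y) * η y) ⊆ K := fun k ↦
    closure_minimal (fun x hx ↦ by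
      by_contra h0
      exact hx (by simp [hη_zero x h0])) (isClosed_tsupport η)
  refine ⟨fun k x ↦ F (w k x) * η x, fun k ↦ ⟨?_, ?_, ?_⟩, fun k x hx ↦ ?_, ⟨|A| * E, fun k x ↦ ?_⟩,
    ?_, ?_⟩
  · refine contDiff_iff_contDiffAt.2 fun x ↦ ?_
    by_cases hx : x ∈ K
    · exact ((hF.contDiffAt (Ioi_mem_nhds (hIcc (hw_mem k x hx)))).comp x
        (hw_smooth k).contDiffAt).mul (hη.contDiff.of_le (by simp)).contDiffAt
    · refine (contDiffAt_const (c := (0 : ℝ))).congr_of_eventuallyEq ?_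
      filter_upwards [notMem_tsupport_iff_eventuallyEq.1 hx] with y hy
      simp [hy]
  · exact HasCompactSupport.of_support_subset_isCompact hKc ((subset_tsupport _).trans (hsupp k))
  · exact (hsupp k).trans hη.tsupport_subset
  · simp [hη_zero x hx]
  · by_cases hx : x ∈ K
    · rw [abs_mul]
      exact mul_le_mul ((hA _ (hw_mem k x hx)).trans (le_abs_self A)) (hE x) (abs_nonneg _)
        (abs_nonneg _)
    · simp only [hη_zero x hx, mul_zero, abs_zero]
      positivity
  · refine ae_restrict_of_ae ?_
    filter_upwards [(ae_restrict_iff' hKm).1 hw_lim, (ae_restrict_iff' hKm).1 hcMK] with x h1 h2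
    by_cases hx : x ∈ K
    · exact ((hF.continuousOn.continuousAt (Ioi_mem_nhds (hIcc (h2 hx)))).tendsto.comp
        (h1 hx)).mul_const _
    · simp [hη_zero x hx]
  -- The gradient error is `D k + F'(w k) η (H k - G)`. The first term tends to 0 by dominated
  -- convergence, the second because `F'(w k) η` is bounded on `K` and `H k → G` in `L²(K)`.
  · set D : ℕ → Euc N → Euc N := fun k x ↦ (F (w k x) - F (u x)) • gradient η x +
      ((deriv F (w k x) - deriv F (u x)) * η x) • G x with hD
    have hupos : ∀ᵐ x ∂(volume.restrict K), 0 < u x := by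
      filter_upwards [hcMK] with x hx using hIcc hx
    have hwpos : ∀ k, ∀ᵐ x ∂(volume.restrict K), 0 < w k x := by
      intro k
      filter_upwards [ae_restrict_mem hKm] with x hx using hIcc (hw_mem k x hx)
    have hum : AEMeasurable u (volume.restrict K) :=
      (huU.mono_set hKU).aemeasurable
    have hGm : MemLp G 2 (volume.restrict K) :=
      (hG.memLp_grad U hUcc).mono_measure (Measure.restrict_mono hKU le_rfl)
    have hwm : ∀ k, AEMeasurable (w k) (volume.restrict K) := fun k ↦
      (hw_smooth k).continuous.aemeasurable
    have hDm : ∀ k, AEMeasurable (fun x ↦ ‖D k x‖ₑ ^ 2) (volume.restrict K) := by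
      intro k
      have h1 := (aemeasurable_comp_of_continuousOn_Ioi hF.continuousOn (hwm k) (hwpos k)).sub
        (aemeasurable_comp_of_continuousOn_Ioi hF.continuousOn hum hupos)
      have h2 := (aemeasurable_comp_of_continuousOn_Ioi hF'_cont (hwm k) (hwpos k)).sub
        (aemeasurable_comp_of_continuousOn_Ioi hF'_cont hum hupos)
      have h3 := (h1.smul hη_cont.aemeasurable).add
        ((h2.mul hη.contDiff.continuous.aemeasurable).smul hGm.1.aemeasurable)
      exact h3.enorm.pow_const 2
    have hle : ∀ k, ∫⁻ x in Ω, ‖gradient (fun y ↦ F (w k y) * η y) x -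
        (F (u x) • gradient η x + (deriv F (u x) * η x) • G x)‖ₑ ^ 2 ≤
        2 * (∫⁻ x in K, ‖D k x‖ₑ ^ 2) + 2 * ENNReal.ofReal (|B| * E) ^ 2 *
          ∫⁻ x in K, ‖H k x - G x‖ₑ ^ 2 := by
      intro k
      have h1 : ∀ x, x ∉ K → ‖gradient (fun y ↦ F (w k y) * η y) x -
          (F (u x) • gradient η x + (deriv F (u x) * η x) • G x)‖ₑ ^ 2 = 0 := by
        intro x hx
        have h0 : fderiv ℝ (fun y ↦ F (w k y) * η y) x = 0 := by
          by_contra h0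
          exact hx (hsupp k (support_fderiv_subset ℝ h0))
        have h0' : gradient (fun y ↦ F (w k y) * η y) x = 0 := by simp [gradient, h0]
        simp [h0', hη_zero x hx, hη_grad_zero x hx]
      have h2 : ∀ x ∈ K, ‖gradient (fun y ↦ F (w k y) * η y) x -
          (F (u x) • gradient η x + (deriv F (u x) * η x) • G x)‖ₑ ^ 2 ≤
          2 * ‖D k x‖ₑ ^ 2 + 2 * ENNReal.ofReal (|B| * E) ^ 2 * ‖H k x - G x‖ₑ ^ 2 := by
        intro x hx
        have h3 : gradient (fun y ↦ F (w k y) * η y) x -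
            (F (u x) • gradient η x + (deriv F (u x) * η x) • G x) =
            D k x + (deriv F (w k x) * η x) • (H k x - G x) := by
          rw [hgrad k x hx]
          simp only [hD]
          module
        rw [h3]
        refine (enorm_add_sq_le _ _).trans ?_
        rw [enorm_smul, mul_pow, mul_assoc]
        gcongr
        rw [← ofReal_norm]
        refine ENNReal.ofReal_le_ofReal ?_
        rw [norm_mul]
        exact mul_le_mul ((hB _ (hw_mem k x hx)).trans (le_abs_self B)) (hE x) (norm_nonneg _)
          (abs_nonneg _)
      rw [lintegral_eq_setLIntegral_of_forall_notMem hKm h1, Measure.restrict_restrict hKm,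
        inter_eq_left.2 hη.tsupport_subset]
      refine (setLIntegral_mono' hKm h2).trans_eq ?_
      rw [lintegral_add_left' ((hDm k).const_mul 2), lintegral_const_mul'' _ (hDm k),
        lintegral_const_mul' _ _ (ENNReal.mul_ne_top ENNReal.ofNat_ne_top
          (ENNReal.pow_ne_top ENNReal.ofReal_ne_top))]
    have hDlim : Tendsto (fun k ↦ ∫⁻ x in K, ‖D k x‖ₑ ^ 2) atTop (𝓝 0) := by
      have hfin : IsFiniteMeasure (volume.restrict K) := ⟨by simpa using hKc.measure_lt_top⟩
      have hb : MemLp (fun x ↦ 2 * |A| * |E'| + 2 * |B| * E * ‖G x‖) 2 (volume.restrict K) :=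
        (memLp_const (2 * |A| * |E'|)).add (hGm.norm.const_mul (2 * |B| * E))
      suffices h0 : Tendsto (fun k ↦ ∫⁻ x in K, ‖D k x‖ₑ ^ 2) atTop (𝓝 (∫⁻ _ in K, 0)) by
        rwa [lintegral_zero] at h0
      refine tendsto_lintegral_of_dominated_convergence'
        (fun x ↦ ‖2 * |A| * |E'| + 2 * |B| * E * ‖G x‖‖ₑ ^ 2) hDm ?_ ?_ ?_
      · intro k
        filter_upwards [ae_restrict_mem hKm, hcMK] with x hx hux
        gcongr
        rw [enorm_le_iff_norm_le]
        have hw' := hw_mem k x hx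
        have a1 : ‖F (w k x) - F (u x)‖ ≤ 2 * |A| :=
          (norm_sub_le _ _).trans (by linarith [hA _ hw', hA _ hux, le_abs_self A])
        have a2 : ‖deriv F (w k x) - deriv F (u x)‖ ≤ 2 * |B| :=
          (norm_sub_le _ _).trans (by linarith [hB _ hw', hB _ hux, le_abs_self B])
        rw [Real.norm_of_nonneg (by positivity)]
        refine (norm_add_le _ _).trans ?_
        rw [norm_smul, norm_smul, norm_mul]
        gcongr
        · exact (hE' x hx).trans (le_abs_self _)
        · exact hE x
      · rw [← sq_eLpNorm_two]
        exact ENNReal.pow_ne_top hb.2.ne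
      · filter_upwards [hw_lim, hcMK] with x hx hux
        have a1 := ((hF.continuousOn.continuousAt (Ioi_mem_nhds (hIcc hux))).tendsto.comp
          hx).sub_const (F (u x))
        have a2 := ((hF'_cont.continuousAt (Ioi_mem_nhds (hIcc hux))).tendsto.comp
          hx).sub_const (deriv F (u x))
        rw [sub_self] at a1 a2
        have a3 : Tendsto (fun k ↦ D k x) atTop (𝓝 0) := by
          simpa using (a1.smul_const (gradient η x)).add ((a2.mul_const (η x)).smul_const (G x))
        simpa using ENNReal.Tendsto.pow (n := 2) a3.enorm
    have h1 := ENNReal.Tendsto.const_mul (a := 2) hDlim (Or.inr (by simp))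
    have h2 := ENNReal.Tendsto.const_mul (a := 2 * ENNReal.ofReal (|B| * E) ^ 2) hH_lim
      (Or.inr (ENNReal.mul_ne_top ENNReal.ofNat_ne_top (ENNReal.pow_ne_top ENNReal.ofReal_ne_top)))
    have h3 := h1.add h2
    rw [mul_zero, mul_zero, add_zero] at h3
    exact tendsto_of_tendsto_of_tendsto_of_le_of_le tendsto_const_nhds h3 (fun _ ↦ zero_le) hle

/-! ### Measurability and integrability of the terms of the equation. -/

/-- Rounding `u` to a grid of mesh `1/(n+1)` leaves countably many values of `s`, so each
approximation is measurable; continuity of `g x` gives the limit. -/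
theorem IsCaratheodory.aemeasurable_comp {N : ℕ} {Ω : Set (Euc N)} {g : Euc N → ℝ → ℝ}
    (hg : IsCaratheodory Ω g) {u : Euc N → ℝ} (hu : AEMeasurable u (volume.restrict Ω))
    (hpos : ∀ᵐ x ∂(volume.restrict Ω), 0 < u x) :
    AEMeasurable (fun x ↦ g x (u x)) (volume.restrict Ω) := by
  -- The shift `j + 1` keeps every grid point in `(0, ∞)`, even when the floor is 0.
  have hs : ∀ n j : ℕ, (0 : ℝ) < (j + 1) / (n + 1) := fun n j ↦ by positivity
  choose p hpm hpe using fun n j : ℕ ↦ hg.aemeasurable _ (hs n j)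
  have hp : ∀ᵐ x ∂(volume.restrict Ω), ∀ n j : ℕ, g x ((j + 1) / (n + 1)) = p n j x :=
    ae_all_iff.2 fun n ↦ ae_all_iff.2 fun j ↦ hpe n j
  obtain ⟨v, hv, huv⟩ := hu
  have hmeas : ∀ n : ℕ, Measurable fun x ↦ p n ⌊v x * (n + 1)⌋₊ x := by
    intro n
    have h1 : Measurable fun q : ℕ × Euc N ↦ p n q.1 q.2 :=
      measurable_from_prod_countable_right fun j ↦ hpm n j
    have h2 : Measurable fun x ↦ ⌊v x * (n + 1)⌋₊ :=
      Nat.measurable_floor.comp (hv.mul_const _)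
    exact h1.comp (h2.prodMk measurable_id)
  refine aemeasurable_of_tendsto_metrizable_ae atTop (fun n ↦ (hmeas n).aemeasurable) ?_
  filter_upwards [hp, huv, hpos, hg.continuousOn] with x hpx hux hx hgx
  have hlim : Tendsto (fun n : ℕ ↦ ((⌊v x * (n + 1)⌋₊ : ℝ) + 1) / (n + 1)) atTop (𝓝 (u x)) := by
    have h1 : Tendsto (fun n : ℕ ↦ (n : ℝ) + 1) atTop atTop :=
      tendsto_atTop_add_const_right _ _ tendsto_natCast_atTop_atTop
    have h2 := (tendsto_nat_floor_mul_div_atTop (R := ℝ) (a := u x) hx.le).comp h1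
    have h3 := h2.add (tendsto_inv_atTop_zero.comp h1)
    rw [add_zero] at h3
    refine h3.congr fun n ↦ ?_
    have hux' : v x = u x := hux.symm
    simp only [Function.comp, hux']
    rw [add_div, one_div]
  have h4 := (hgx.continuousAt (Ioi_mem_nhds hx)).tendsto.comp hlim
  exact h4.congr fun n ↦ hpx n _

theorem ae_pos_of_locally {N : ℕ} {Ω : Set (Euc N)} (hΩ : IsOpen Ω) {u : Euc N → ℝ}
    (hpos : ∀ ω, CompactlyContained ω Ω → ∃ c : ℝ, 0 < c ∧ ∀ᵐ x ∂(volume.restrict ω), c ≤ u x) :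
    ∀ᵐ x ∂(volume.restrict Ω), 0 < u x := by
  rw [ae_restrict_iff' hΩ.measurableSet, ae_iff]
  refine measure_null_of_locally_null _ fun x hx ↦ ?_
  have hxΩ : x ∈ Ω := by
    by_contra h
    exact hx fun h' ↦ absurd h' h
  obtain ⟨r, hr, hrΩ⟩ := Metric.nhds_basis_closedBall.mem_iff.1 (hΩ.mem_nhds hxΩ)
  have hball : CompactlyContained (Metric.closedBall x r) Ω := by
    refine ⟨?_, ?_⟩ <;> rw [Metric.isClosed_closedBall.closure_eq]
    exacts [isCompact_closedBall x r, hrΩ]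
  obtain ⟨c, hc, hcu⟩ := hpos _ hball
  rw [ae_restrict_iff' Metric.isClosed_closedBall.measurableSet, ae_iff] at hcu
  refine ⟨{y | ¬(y ∈ Ω → 0 < u y)} ∩ Metric.closedBall x r,
    inter_mem_nhdsWithin _ (Metric.closedBall_mem_nhds x hr), measure_mono_null ?_ hcu⟩
  intro y hy h
  exact hy.1 fun _ ↦ hc.trans_le (h hy.2)

theorem compactlyContained_of_isCompact {N : ℕ} {K Ω : Set (Euc N)} (hK : IsCompact K)
    (hKΩ : K ⊆ Ω) : CompactlyContained K Ω := by
  refine ⟨?_, ?_⟩ <;> rwa [hK.isClosed.closure_eq]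

theorem exists_bound_comp {N : ℕ} {K Ω : Set (Euc N)} (hK : IsCompact K) (hKΩ : K ⊆ Ω)
    {u : Euc N → ℝ} {M : ℝ} (hM : ∀ᵐ x ∂(volume.restrict Ω), u x ≤ M)
    (hpos : ∀ ω, CompactlyContained ω Ω → ∃ c : ℝ, 0 < c ∧ ∀ᵐ x ∂(volume.restrict ω), c ≤ u x)
    {F : ℝ → ℝ} (hF : ContinuousOn F (Ioi 0)) :
    ∃ C, 0 ≤ C ∧ ∀ᵐ x ∂(volume.restrict Ω), x ∈ K → |F (u x)| ≤ C := by
  obtain ⟨c, hc, hcu⟩ := hpos K (compactlyContained_of_isCompact hK hKΩ)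
  obtain ⟨C, hC⟩ := (isCompact_Icc (a := c) (b := M)).exists_bound_of_continuousOn
    (hF.mono fun s hs ↦ hc.trans_le hs.1)
  refine ⟨|C|, abs_nonneg C, ?_⟩
  filter_upwards [hM, ae_restrict_of_ae ((ae_restrict_iff' hK.measurableSet).1 hcu)]
    with x h1 h2 hx
  exact (hC _ ⟨h2 hx, h1⟩).trans (le_abs_self C)

theorem integrableOn_mul_sq_norm {N : ℕ} {K Ω : Set (Euc N)} (hK : IsCompact K) (hKΩ : K ⊆ Ω)
    {u : Euc N → ℝ} {G : Euc N → Euc N} (hG : MemH1loc Ω u G) {q : Euc N → ℝ} {C : ℝ}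
    (hq : AEStronglyMeasurable q (volume.restrict Ω))
    (hb : ∀ᵐ x ∂(volume.restrict Ω), |q x| ≤ K.indicator (fun _ ↦ C) x) :
    IntegrableOn (fun x ↦ q x * ‖G x‖ ^ 2) Ω := by
  have h1 : Integrable (fun x ↦ ‖G x‖ ^ 2) (volume.restrict K) :=
    (hG.memLp_grad K (compactlyContained_of_isCompact hK hKΩ)).integrable_norm_pow (by norm_num)
  have h2 : Integrable (K.indicator fun x ↦ C * ‖G x‖ ^ 2) (volume.restrict Ω) :=
    ((IntegrableOn.integrable_indicator (h1.const_mul C) hK.measurableSet)).integrableOn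
  refine h2.mono' (hq.mul (hG.hasWeakGradient.locallyIntegrableOn_grad.aestronglyMeasurable.norm.pow
    2)) ?_
  filter_upwards [hb] with x hx
  rw [norm_mul, Real.norm_eq_abs, norm_pow, norm_norm]
  by_cases hxK : x ∈ K
  · simp only [hxK, indicator_of_mem] at hx ⊢
    gcongr
  · simp only [hxK, not_false_eq_true, indicator_of_notMem] at hx ⊢
    simp [abs_nonpos_iff.1 hx]

theorem IsTestFunction.continuous_gradient {N : ℕ} {k : ℕ∞} {Ω : Set (Euc N)} {φ : Euc N → ℝ}
    (hφ : IsTestFunction k Ω φ) (hk : k ≠ 0) : Continuous (gradient φ) :=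
  (LinearIsometryEquiv.continuous _).comp (hφ.contDiff.continuous_fderiv (by simpa using hk))

theorem IsTestFunction.memLp_gradient {N : ℕ} {k : ℕ∞} {Ω : Set (Euc N)} {φ : Euc N → ℝ}
    (hφ : IsTestFunction k Ω φ) (hk : k ≠ 0) : MemLp (gradient φ) 2 (volume.restrict Ω) :=
  ((hφ.continuous_gradient hk).memLp_of_hasCompactSupport
    ((hφ.hasCompactSupport.fderiv ℝ).comp_left (map_zero _))).restrict Ω

theorem memLp_two_iff {α E : Type*} [MeasurableSpace α] [NormedAddCommGroup E] {μ : Measure α}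
    {f : α → E} (hf : AEStronglyMeasurable f μ) : MemLp f 2 μ ↔ ∫⁻ x, ‖f x‖ₑ ^ 2 ∂μ ≠ ⊤ := by
  rw [← sq_eLpNorm_two]
  constructor
  · exact fun h ↦ ENNReal.pow_ne_top h.2.ne
  · exact fun h ↦ ⟨hf, lt_top_iff_ne_top.2 fun h' ↦ h (by simp [h'])⟩

/-! ### The weak formulation and the Poincaré inequality for `F(u) η`. -/

section Composition

variable {N : ℕ} {Ω : Set (Euc N)} {u : Euc N → ℝ} {G : Euc N → Euc N} {M : ℝ}

theorem aestronglyMeasurable_grad_comp_mul (hG : MemH1loc Ω u G)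
    (hu : AEMeasurable u (volume.restrict Ω)) (hpos : ∀ᵐ x ∂(volume.restrict Ω), 0 < u x)
    {F : ℝ → ℝ} (hF : ContDiffOn ℝ 1 F (Ioi 0)) {η : Euc N → ℝ} (hη : IsTestFunction ⊤ Ω η) :
    AEStronglyMeasurable (fun x ↦ F (u x) • gradient η x + (deriv F (u x) * η x) • G x)
      (volume.restrict Ω) :=
  ((aemeasurable_comp_of_continuousOn_Ioi hF.continuousOn hu hpos).aestronglyMeasurable.smul
    (hη.continuous_gradient (by simp)).aestronglyMeasurable).add
    (((aemeasurable_comp_of_continuousOn_Ioi (hF.continuousOn_deriv_of_isOpen isOpen_Ioi le_rfl)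
      hu hpos).aestronglyMeasurable.mul hη.contDiff.continuous.aestronglyMeasurable).smul
      hG.hasWeakGradient.locallyIntegrableOn_grad.aestronglyMeasurable)

/-- Some approximating test function has its gradient, which is in `L²`, at finite `L²` distance
from this field. -/
theorem memLp_grad_comp_mul (hΩ : IsOpen Ω) (hG : MemH1loc Ω u G)
    (hu : AEMeasurable u (volume.restrict Ω)) (hM : ∀ᵐ x ∂(volume.restrict Ω), u x ≤ M)
    (hpos : ∀ ω, CompactlyContained ω Ω → ∃ c : ℝ, 0 < c ∧ ∀ᵐ x ∂(volume.restrict ω), c ≤ u x)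
    {F : ℝ → ℝ} (hF : ContDiffOn ℝ 1 F (Ioi 0)) {η : Euc N → ℝ} (hη : IsTestFunction ⊤ Ω η) :
    MemLp (fun x ↦ F (u x) • gradient η x + (deriv F (u x) * η x) • G x) 2
      (volume.restrict Ω) := by
  obtain ⟨φ, hφ, -, -, -, hlim⟩ := exists_testFunction_approx hΩ hG hM hpos hF hη
  have hT := aestronglyMeasurable_grad_comp_mul hG hu (ae_pos_of_locally hΩ hpos) hF hη
  obtain ⟨k, hk⟩ := (hlim.eventually (gt_mem_nhds one_pos)).exists
  have h1 := (hφ k).memLp_gradient (by simp)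
  have h2 := (memLp_two_iff (h1.1.sub hT)).2 (hk.trans ENNReal.one_lt_top).ne
  refine (h1.sub h2).ae_eq (Eventually.of_forall fun x ↦ ?_)
  simp

/-- The weak formulation extends to test functions of the form `F(u) η`. -/
theorem weak_formulation_comp_mul (hΩ : IsOpen Ω) {h : Euc N → ℝ} (hh : IntegrableOn h Ω)
    {g : Euc N → ℝ → ℝ} (hg : IsCaratheodory Ω g) (hg₀ : LocallyControlled Ω g)
    (hG : MemH1loc Ω u G)
    (hu : AEMeasurable u (volume.restrict Ω)) (hM : ∀ᵐ x ∂(volume.restrict Ω), u x ≤ M)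
    (hpos : ∀ ω, CompactlyContained ω Ω → ∃ c : ℝ, 0 < c ∧ ∀ᵐ x ∂(volume.restrict ω), c ≤ u x)
    (heq : ∀ φ : Euc N → ℝ, IsTestFunction 1 Ω φ →
      (∫ x in Ω, inner ℝ (G x) (gradient φ x)) + ∫ x in Ω, g x (u x) * ‖G x‖ ^ 2 * φ x
        = ∫ x in Ω, h x * φ x)
    {F : ℝ → ℝ} (hF : ContDiffOn ℝ 1 F (Ioi 0)) {η : Euc N → ℝ} (hη : IsTestFunction ⊤ Ω η) :
    IntegrableOn (fun x ↦ inner ℝ (G x)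
      (F (u x) • gradient η x + (deriv F (u x) * η x) • G x)) Ω ∧
    IntegrableOn (fun x ↦ g x (u x) * ‖G x‖ ^ 2 * (F (u x) * η x)) Ω ∧
    IntegrableOn (fun x ↦ h x * (F (u x) * η x)) Ω ∧
    (∫ x in Ω, inner ℝ (G x) (F (u x) • gradient η x + (deriv F (u x) * η x) • G x)) +
      ∫ x in Ω, g x (u x) * ‖G x‖ ^ 2 * (F (u x) * η x) = ∫ x in Ω, h x * (F (u x) * η x) := by
  obtain ⟨φ, hφ, hφ_zero, ⟨C, hC⟩, hφ_lim, hlim⟩ :=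
    exists_testFunction_approx hΩ hG hM hpos hF hη
  have hu_pos := ae_pos_of_locally hΩ hpos
  have hT2 := memLp_grad_comp_mul hΩ hG hu hM hpos hF hη
  set T := fun x ↦ F (u x) • gradient η x + (deriv F (u x) * η x) • G x with hTdef
  set K := tsupport η with hK
  have hKc : IsCompact K := hη.hasCompactSupport
  have hKΩ : K ⊆ Ω := hη.tsupport_subset
  have hKm : MeasurableSet K := hKc.measurableSet
  have hGm : AEStronglyMeasurable G (volume.restrict Ω) :=
    hG.hasWeakGradient.locallyIntegrableOn_grad.aestronglyMeasurable
  have hGK : MemLp (K.indicator G) 2 (volume.restrict Ω) :=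
    ((memLp_indicator_iff_restrict hKm).2
      (hG.memLp_grad K (compactlyContained_of_isCompact hKc hKΩ))).restrict Ω
  have hη_zero : ∀ x, x ∉ K → η x = 0 := fun x hx ↦ image_eq_zero_of_notMem_tsupport hx
  have hη_grad_zero : ∀ x, x ∉ K → gradient η x = 0 := fun x hx ↦ by
    have h0 : fderiv ℝ η x = 0 := by
      by_contra h0
      exact hx (support_fderiv_subset ℝ h0)
    simp [gradient, h0]
  have hT_zero : ∀ x, x ∉ K → T x = 0 := fun x hx ↦ by
    simp [hTdef, hη_zero x hx, hη_grad_zero x hx]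
  have hφ_grad_zero : ∀ k x, x ∉ K → gradient (φ k) x = 0 := fun k x hx ↦ by
    have h0 : fderiv ℝ (φ k) x = 0 := by
      by_contra h0
      have h1 : tsupport (φ k) ⊆ K := closure_minimal (fun y hy ↦ by
        by_contra h2
        exact hy (hφ_zero k y h2)) (isClosed_tsupport η)
      exact hx (h1 (support_fderiv_subset ℝ h0))
    simp [gradient, h0]
  -- `G` is only locally square integrable, so it is cut off to `K`, outside which all the gradients
  -- involved vanish.
  have hinner : ∀ {S : Euc N → Euc N}, (∀ x, x ∉ K → S x = 0) →
      ∀ x, inner ℝ (G x) (S x) = inner ℝ (K.indicator G x) (S x) := by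
    intro S hS x
    by_cases hx : x ∈ K
    · simp [hx]
    · simp [hS x hx]
  have hint : ∀ {S : Euc N → Euc N}, (∀ x, x ∉ K → S x = 0) → MemLp S 2 (volume.restrict Ω) →
      IntegrableOn (fun x ↦ inner ℝ (G x) (S x)) Ω := by
    intro S hS hS2
    simp_rw [hinner hS]
    exact (hGK.norm.integrable_mul hS2.norm).mono' (hGK.1.inner hS2.1)
      (Eventually.of_forall fun x ↦ norm_inner_le_norm _ _)
  have lim1 : Tendsto (fun k ↦ ∫ x in Ω, inner ℝ (G x) (gradient (φ k) x)) atTop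
      (𝓝 (∫ x in Ω, inner ℝ (G x) (T x))) := by
    refine tendsto_integral_of_L1 _ (hint hT_zero hT2).1
      (Eventually.of_forall fun k ↦ hint (hφ_grad_zero k) ((hφ k).memLp_gradient (by simp))) ?_
    have hS : ∀ k, MemLp (fun x ↦ gradient (φ k) x - T x) 2 (volume.restrict Ω) := fun k ↦
      ((hφ k).memLp_gradient (by simp)).sub hT2
    have hle : ∀ k, ∫⁻ x in Ω, ‖inner ℝ (G x) (gradient (φ k) x) - inner ℝ (G x) (T x)‖ₑ ≤
        ((∫⁻ x in Ω, ‖K.indicator G x‖ₑ ^ 2) * ∫⁻ x in Ω, ‖gradient (φ k) x - T x‖ₑ ^ 2) ^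
          (1 / 2 : ℝ) := by
      intro k
      rw [← ENNReal.rpow_le_rpow_iff (z := 2) (by norm_num), ← ENNReal.rpow_mul,
        show (1 / 2 : ℝ) * 2 = 1 by norm_num, ENNReal.rpow_one, ENNReal.rpow_two]
      refine le_trans (pow_le_pow_left' (lintegral_mono fun x ↦ ?_) 2)
        (sq_lintegral_mul_le hGK.1.enorm (hS k).1.enorm)
      rw [← inner_sub_right, hinner (S := fun x ↦ gradient (φ k) x - T x)
        (fun x hx ↦ by simp [hφ_grad_zero k x hx, hT_zero x hx])]
      rw [← ofReal_norm, ← ofReal_norm, ← ofReal_norm, ← ENNReal.ofReal_mul (norm_nonneg _)]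
      exact ENNReal.ofReal_le_ofReal (norm_inner_le_norm _ _)
    have h1 := (ENNReal.continuous_rpow_const (y := 1 / 2)).tendsto _ |>.comp
      (ENNReal.Tendsto.const_mul (a := ∫⁻ x in Ω, ‖K.indicator G x‖ₑ ^ 2) hlim
        (Or.inr ((memLp_two_iff hGK.1).1 hGK)))
    rw [mul_zero, ENNReal.zero_rpow_of_pos (by norm_num)] at h1
    exact tendsto_of_tendsto_of_tendsto_of_le_of_le tendsto_const_nhds h1 (fun _ ↦ zero_le) hle
  obtain ⟨g₀, hg₀_cont, hg₀_le⟩ := hg₀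
  obtain ⟨Γ, hΓ0, hΓ⟩ := exists_bound_comp hKc hKΩ hM hpos hg₀_cont
  have hgm := hg.aemeasurable_comp hu hu_pos
  have hC0 : 0 ≤ C := (abs_nonneg _).trans (hC 0 0)
  have hFη_le : ∀ᵐ x ∂(volume.restrict Ω), |F (u x) * η x| ≤ C := by
    filter_upwards [hφ_lim] with x hx
    exact le_of_tendsto hx.abs (Eventually.of_forall fun k ↦ hC k x)
  have hFηm : AEStronglyMeasurable (fun x ↦ F (u x) * η x) (volume.restrict Ω) :=
    ((aemeasurable_comp_of_continuousOn_Ioi hF.continuousOn hu hu_pos).mul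
      hη.contDiff.continuous.aemeasurable).aestronglyMeasurable
  have hgle : ∀ {s : Euc N → ℝ}, (∀ x, x ∉ K → s x = 0) →
      (∀ᵐ x ∂(volume.restrict Ω), |s x| ≤ C) → ∀ᵐ x ∂(volume.restrict Ω),
        |g x (u x) * s x| ≤ K.indicator (fun _ ↦ Γ * C) x := by
    intro s hs hsC
    filter_upwards [hg₀_le, hu_pos, hΓ, hsC] with x h1 h2 h3 h4
    by_cases hx : x ∈ K
    · rw [indicator_of_mem hx, abs_mul]
      exact mul_le_mul (((h1 _ h2).trans (le_abs_self _)).trans (h3 hx)) h4 (abs_nonneg _) hΓ0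
    · simp [hx, hs x hx]
  have hFη_zero : ∀ x, x ∉ K → F (u x) * η x = 0 := fun x hx ↦ by simp [hη_zero x hx]
  have int2 : IntegrableOn (fun x ↦ g x (u x) * ‖G x‖ ^ 2 * (F (u x) * η x)) Ω := by
    refine (integrableOn_mul_sq_norm hKc hKΩ hG (hgm.aestronglyMeasurable.mul hFηm)
      (hgle hFη_zero hFη_le)).congr (Eventually.of_forall fun x ↦ ?_)
    simp only [Pi.mul_apply]
    ring
  have hbound : IntegrableOn (fun x ↦ K.indicator (fun _ ↦ Γ * C) x * ‖G x‖ ^ 2) Ω := by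
    refine integrableOn_mul_sq_norm (C := Γ * C) hKc hKΩ hG
      (measurable_const.indicator hKm).aestronglyMeasurable (Eventually.of_forall fun x ↦ ?_)
    rw [abs_of_nonneg (indicator_nonneg (fun _ _ ↦ by positivity) x)]
  have lim2 : Tendsto (fun k ↦ ∫ x in Ω, g x (u x) * ‖G x‖ ^ 2 * φ k x) atTop
      (𝓝 (∫ x in Ω, g x (u x) * ‖G x‖ ^ 2 * (F (u x) * η x))) := by
    refine tendsto_integral_of_dominated_convergence _ (fun k ↦
      (hgm.aestronglyMeasurable.mul (hGm.norm.pow 2)).mul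
        (hφ k).contDiff.continuous.aestronglyMeasurable) hbound (fun k ↦ ?_) ?_
    · filter_upwards [hgle (hφ_zero k) (Eventually.of_forall (hC k))] with x hx
      rw [mul_right_comm, norm_mul, norm_pow, norm_norm]
      exact mul_le_mul_of_nonneg_right hx (by positivity)
    · filter_upwards [hφ_lim] with x hx using hx.const_mul _
  have lim3 : Tendsto (fun k ↦ ∫ x in Ω, h x * φ k x) atTop
      (𝓝 (∫ x in Ω, h x * (F (u x) * η x))) := by
    refine tendsto_integral_of_dominated_convergence (fun x ↦ ‖h x‖ * C) (fun k ↦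
      hh.1.mul (hφ k).contDiff.continuous.aestronglyMeasurable) (hh.norm.mul_const C)
      (fun k ↦ Eventually.of_forall fun x ↦ ?_) ?_
    · rw [norm_mul]
      exact mul_le_mul_of_nonneg_left (hC k x) (norm_nonneg _)
    · filter_upwards [hφ_lim] with x hx using hx.const_mul _
  refine ⟨hint hT_zero hT2, int2, hh.mul_bdd hFηm hFη_le, ?_⟩
  exact tendsto_nhds_unique ((lim1.add lim2).congr fun k ↦ heq (φ k) (hφ k)) lim3

/-- The Poincaré inequality for functions of the form `F(u) η`. -/
theorem exists_poincare_comp_mul (hN : 3 ≤ N) (hΩ : IsOpen Ω) (hΩ_bdd : Bornology.IsBounded Ω) :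
    ∃ C : ENNReal, C ≠ ⊤ ∧ ∀ {u : Euc N → ℝ} {G : Euc N → Euc N} {M : ℝ},
      MemH1loc Ω u G → AEMeasurable u (volume.restrict Ω) →
      (∀ᵐ x ∂(volume.restrict Ω), u x ≤ M) →
      (∀ ω, CompactlyContained ω Ω → ∃ c : ℝ, 0 < c ∧ ∀ᵐ x ∂(volume.restrict ω), c ≤ u x) →
      ∀ {F : ℝ → ℝ}, ContDiffOn ℝ 1 F (Ioi 0) → ∀ {η : Euc N → ℝ}, IsTestFunction ⊤ Ω η →
      ∫⁻ x in Ω, ‖F (u x) * η x‖ₑ ^ 2 ≤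
        C * ∫⁻ x in Ω, ‖F (u x) • gradient η x + (deriv F (u x) * η x) • G x‖ₑ ^ 2 := by
  -- The Sobolev constant on the bounded set `Ω` with both exponents 2, available since `2 < N`. It
  -- depends neither on `F` nor on `η`, both of which later vary with `m`.
  set D : NNReal := eLpNormLESNormFDerivOfLeConst ℝ (volume : Measure (Euc N)) Ω 2 2
  refine ⟨2 * D ^ 2, ENNReal.mul_ne_top (by simp) (by simp), ?_⟩
  intro u G M hG hu hM hpos F hF η hη
  obtain ⟨φ, hφ, -, -, hφ_lim, hlim⟩ := exists_testFunction_approx hΩ hG hM hpos hF hη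
  have hT := aestronglyMeasurable_grad_comp_mul hG hu (ae_pos_of_locally hΩ hpos) hF hη
  set T := fun x ↦ F (u x) • gradient η x + (deriv F (u x) * η x) • G x with hTdef
  have hP : ∀ k, ∫⁻ x in Ω, ‖φ k x‖ₑ ^ 2 ≤
      2 * D ^ 2 * (∫⁻ x in Ω, ‖T x‖ₑ ^ 2) +
        2 * D ^ 2 * ∫⁻ x in Ω, ‖gradient (φ k) x - T x‖ₑ ^ 2 := by
    intro k
    have h1 : eLpNorm (φ k) 2 volume ≤ D * eLpNorm (fderiv ℝ (φ k)) 2 volume :=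
      eLpNorm_le_eLpNorm_fderiv (p := 2) volume (hφ k).contDiff
        ((subset_tsupport _).trans (hφ k).tsupport_subset) (by norm_num)
        (by rw [finrank_euclideanSpace_fin]; exact_mod_cast hN) hΩ_bdd
    have h2 := pow_le_pow_left' h1 2
    rw [mul_pow, sq_eLpNorm_two, sq_eLpNorm_two] at h2
    have h3 : ∫⁻ x, ‖fderiv ℝ (φ k) x‖ₑ ^ 2 = ∫⁻ x in Ω, ‖gradient (φ k) x‖ₑ ^ 2 := by
      have h4 : ∀ x, ‖fderiv ℝ (φ k) x‖ₑ = ‖gradient (φ k) x‖ₑ := fun x ↦ by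
        simp only [gradient, ← ofReal_norm, LinearIsometryEquiv.norm_map]
      simp_rw [← h4]
      refine lintegral_eq_setLIntegral_of_forall_notMem hΩ.measurableSet fun x hx ↦ ?_
      have h0 : fderiv ℝ (φ k) x = 0 := by
        by_contra h0
        exact hx ((hφ k).tsupport_subset (support_fderiv_subset ℝ h0))
      have h5 : gradient (φ k) x = 0 := by simp [gradient, h0]
      simp [h4, h5]
    calc ∫⁻ x in Ω, ‖φ k x‖ₑ ^ 2 ≤ ∫⁻ x, ‖φ k x‖ₑ ^ 2 := setLIntegral_le_lintegral _ _
      _ ≤ D ^ 2 * ∫⁻ x in Ω, ‖gradient (φ k) x‖ₑ ^ 2 := h3 ▸ h2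
      _ ≤ D ^ 2 * ∫⁻ x in Ω, (2 * ‖T x‖ₑ ^ 2 + 2 * ‖gradient (φ k) x - T x‖ₑ ^ 2) := by
        gcongr with x
        simpa using enorm_add_sq_le (T x) (gradient (φ k) x - T x)
      _ = _ := by
        rw [lintegral_add_left' ((hT.enorm.pow_const 2).const_mul 2),
          lintegral_const_mul' _ _ (by simp), lintegral_const_mul' _ _ (by simp)]
        ring
  have hR := (ENNReal.Tendsto.const_mul (a := 2 * (D : ENNReal) ^ 2) hlim
    (Or.inr (ENNReal.mul_ne_top (by simp) (by simp)))).const_add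
      (2 * D ^ 2 * (∫⁻ x in Ω, ‖T x‖ₑ ^ 2))
  rw [mul_zero, add_zero] at hR
  -- Almost everywhere convergence and Fatou's lemma pass the inequality to the limit.
  calc ∫⁻ x in Ω, ‖F (u x) * η x‖ₑ ^ 2
      = ∫⁻ x in Ω, liminf (fun k ↦ ‖φ k x‖ₑ ^ 2) atTop := by
        refine lintegral_congr_ae ?_
        filter_upwards [hφ_lim] with x hx
        exact (ENNReal.Tendsto.pow (n := 2) hx.enorm).liminf_eq.symm
    _ ≤ liminf (fun k ↦ ∫⁻ x in Ω, ‖φ k x‖ₑ ^ 2) atTop :=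
        lintegral_liminf_le fun k ↦ ((hφ k).contDiff.continuous.enorm.measurable.pow_const 2)
    _ ≤ liminf (fun k ↦ 2 * D ^ 2 * (∫⁻ x in Ω, ‖T x‖ₑ ^ 2) +
        2 * D ^ 2 * ∫⁻ x in Ω, ‖gradient (φ k) x - T x‖ₑ ^ 2) atTop :=
        liminf_le_liminf (Eventually.of_forall hP)
    _ = _ := hR.liminf_eq

end Composition

/-! ### Smooth transitions and cutoffs built from an `H¹₀` function. -/

theorem Real.smoothTransition.deriv_of_neg {x : ℝ} (hx : x < 0) :
    deriv Real.smoothTransition x = 0 := by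
  have h : Real.smoothTransition =ᶠ[𝓝 x] fun _ ↦ 0 := by
    filter_upwards [gt_mem_nhds hx] with y hy using Real.smoothTransition.zero_of_nonpos hy.le
  rw [h.deriv_eq, deriv_const]

theorem Real.smoothTransition.deriv_of_one_lt {x : ℝ} (hx : 1 < x) :
    deriv Real.smoothTransition x = 0 := by
  have h : Real.smoothTransition =ᶠ[𝓝 x] fun _ ↦ 1 := by
    filter_upwards [lt_mem_nhds hx] with y hy using Real.smoothTransition.one_of_one_le hy.le
  rw [h.deriv_eq, deriv_const]

theorem Real.smoothTransition.differentiable : Differentiable ℝ Real.smoothTransition :=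
  Real.smoothTransition.contDiff (n := 1) |>.differentiable one_ne_zero

theorem Real.smoothTransition.exists_abs_deriv_le :
    ∃ L, 0 ≤ L ∧ ∀ x, |deriv Real.smoothTransition x| ≤ L := by
  obtain ⟨L, hL⟩ := (isCompact_Icc (a := (0 : ℝ)) (b := 1)).exists_bound_of_continuousOn
    (Real.smoothTransition.contDiff (n := 1) |>.continuous_deriv le_rfl).continuousOn
  have hL0 : 0 ≤ L := (norm_nonneg _).trans (hL 0 (by simp))
  refine ⟨L, hL0, fun x ↦ ?_⟩
  rcases lt_or_ge x 0 with h0 | h0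
  · simpa [Real.smoothTransition.deriv_of_neg h0]
  · rcases lt_or_ge 1 x with h1 | h1
    · simpa [Real.smoothTransition.deriv_of_one_lt h1]
    · exact hL x ⟨h0, h1⟩

/-- Where a function `w` of `H¹₀(Ω)` is at least `r`, the constant `1` is approximated by test
functions with small gradient. -/
theorem exists_cutoff {N : ℕ} {Ω : Set (Euc N)} {w : Euc N → ℝ} (hw : MemH10 Ω w) {r : ℝ}
    (hr : 0 < r) {δ : ENNReal} (hδ : 0 < δ) :
    ∃ η : Euc N → ℝ, IsTestFunction ⊤ Ω η ∧ (∀ x, 0 ≤ η x ∧ η x ≤ 1) ∧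
      ∫⁻ x in Ω, {x | r ≤ w x}.indicator (fun x ↦ ‖gradient η x‖ₑ ^ 2) x ≤ δ ∧
      volume.restrict Ω {x | r ≤ w x ∧ η x ≠ 1} ≤ δ := by
  obtain ⟨G, -, hw2, hG2, happrox⟩ := hw
  obtain ⟨L, hL0, hL⟩ := Real.smoothTransition.exists_abs_deriv_le
  set μ := volume.restrict Ω with hμ
  set A : ENNReal := ENNReal.ofReal (4 / r * L) ^ 2 with hA
  have hA_top : A ≠ ⊤ := ENNReal.pow_ne_top ENNReal.ofReal_ne_top
  -- Absolute continuity of the integral of `‖G‖²`: it is small over any set of measure below `κ`.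
  obtain ⟨κ, hκ, hκG⟩ : ∃ κ > 0, ∀ s, μ s < κ → A * (2 * ∫⁻ x in s, ‖G x‖ₑ ^ 2 ∂μ) ≤ δ / 2 := by
    have h1 : δ / 2 / (2 * A + 1) ≠ 0 := by
      refine (ENNReal.div_pos (ENNReal.half_pos hδ.ne').ne' ?_).ne'
      exact ENNReal.add_ne_top.2 ⟨ENNReal.mul_ne_top (by simp) hA_top, by simp⟩
    obtain ⟨κ, hκ, h⟩ := exists_pos_setLIntegral_lt_of_measure_lt ((memLp_two_iff hG2.1).1 hG2) h1
    refine ⟨κ, hκ, fun s hs ↦ ?_⟩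
    calc A * (2 * ∫⁻ x in s, ‖G x‖ₑ ^ 2 ∂μ) ≤ (2 * A + 1) * (δ / 2 / (2 * A + 1)) := by
          rw [← mul_assoc, mul_comm A]
          gcongr
          · exact le_self_add
          · exact (h s hs).le
      _ ≤ δ / 2 := ENNReal.mul_div_le
  set B : ENNReal := ENNReal.ofReal (r / 2) ^ 2 with hB
  have hB0 : B ≠ 0 := by
    simp only [hB, ne_eq, OfNat.ofNat_ne_zero, not_false_eq_true, pow_eq_zero_iff,
      ENNReal.ofReal_eq_zero, not_le]
    positivity
  have hBtop : B ≠ ⊤ := ENNReal.pow_ne_top ENNReal.ofReal_ne_top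
  -- By Chebyshev, `ε² / B` will bound the measure of `{|w - φ| ≥ r/2}`. It must be below `κ`, for
  -- the energy of `G` on that set, and below `δ`, for the set where `η ≠ 1`.
  obtain ⟨ε, hε, hεκ, hεδ, hεA⟩ : ∃ ε : ENNReal, 0 < ε ∧ ε ^ 2 / B < κ ∧ ε ^ 2 / B < δ ∧
      A * (2 * ε ^ 2) < δ / 2 := by
    have t0 : Tendsto (fun ε : ENNReal ↦ ε ^ 2) (𝓝[>] 0) (𝓝 0) := by
      have := (ENNReal.continuous_pow 2).tendsto (0 : ENNReal)
      rw [zero_pow two_ne_zero] at this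
      exact this.mono_left nhdsWithin_le_nhds
    have t1 : Tendsto (fun ε : ENNReal ↦ ε ^ 2 / B) (𝓝[>] 0) (𝓝 0) := by
      simpa using ENNReal.Tendsto.div_const t0 (Or.inr hB0)
    have t2 : Tendsto (fun ε : ENNReal ↦ A * (2 * ε ^ 2)) (𝓝[>] 0) (𝓝 0) := by
      simpa using ENNReal.Tendsto.const_mul (ENNReal.Tendsto.const_mul t0 (Or.inr (by simp)))
        (Or.inr hA_top)
    have hne : (𝓝[>] (0 : ENNReal)).NeBot := inferInstance
    exact (((t1.eventually (gt_mem_nhds hκ)).and ((t1.eventually (gt_mem_nhds hδ)).and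
      (t2.eventually (gt_mem_nhds (ENNReal.half_pos hδ.ne'))))).and self_mem_nhdsWithin).exists.imp
      fun ε h ↦ ⟨h.2, h.1.1, h.1.2.1, h.1.2.2⟩
  obtain ⟨φ, hφ, hφw, hφG⟩ := happrox ε hε
  have hφ_cont : Continuous φ := hφ.contDiff.continuous
  have hφw2 : ∫⁻ x, ‖w x - φ x‖ₑ ^ 2 ∂μ ≤ ε ^ 2 := by
    rw [← sq_eLpNorm_two]
    exact pow_le_pow_left' hφw.le 2
  have hφG2 : ∫⁻ x, ‖G x - gradient φ x‖ₑ ^ 2 ∂μ ≤ ε ^ 2 := by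
    rw [← sq_eLpNorm_two]
    exact pow_le_pow_left' hφG.le 2
  set s : Set (Euc N) := {x | B ≤ ‖w x - φ x‖ₑ ^ 2} with hs
  have hdiff_meas : AEMeasurable (fun x ↦ ‖w x - φ x‖ₑ ^ 2) μ :=
    (hw2.1.sub hφ_cont.aestronglyMeasurable).enorm.pow_const 2
  have hs_meas : NullMeasurableSet s μ := nullMeasurableSet_le aemeasurable_const hdiff_meas
  have hμs : μ s ≤ ε ^ 2 / B :=
    (meas_ge_le_lintegral_div hdiff_meas hB0 hBtop).trans (by gcongr)
  have hmem : ∀ x, r ≤ w x → φ x ≤ r / 2 → x ∈ s := by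
    intro x h1 h2
    simp only [hs, hB, mem_ofPred_eq]
    gcongr
    rw [← ofReal_norm]
    exact ENNReal.ofReal_le_ofReal ((by linarith : r / 2 ≤ w x - φ x).trans (le_abs_self _))
  -- This is 0 where `φ ≤ r/4` and 1 where `φ ≥ r/2`. Hence on `{w ≥ r}` its gradient can be nonzero
  -- only where `|w - φ| ≥ r/2`, that is on `s`.
  set η : Euc N → ℝ := fun x ↦ Real.smoothTransition (4 / r * φ x - 1) with hη
  have hη_supp : Function.support η ⊆ tsupport φ := by
    intro x hx
    by_contra h0
    refine hx (Real.smoothTransition.zero_of_nonpos ?_)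
    simp [image_eq_zero_of_notMem_tsupport h0]
  have hη_one : ∀ x, r / 2 ≤ φ x → η x = 1 := by
    intro x hx
    refine Real.smoothTransition.one_of_one_le ?_
    have : 4 / r * (r / 2) ≤ 4 / r * φ x := by gcongr
    have h2 : 4 / r * (r / 2) = 2 := by field_simp; norm_num
    linarith
  have hgrad : ∀ x, HasGradientAt η
      ((deriv Real.smoothTransition (4 / r * φ x - 1) * (4 / r)) • gradient φ x) x := by
    intro x
    have h1 : HasFDerivAt φ (fderiv ℝ φ x) x :=
      ((hφ.contDiff.differentiable (by simp)) x).hasFDerivAt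
    have h2 := (Real.smoothTransition.differentiable (4 / r * φ x - 1)).hasDerivAt.comp_hasFDerivAt
      x ((h1.const_mul (4 / r)).sub_const 1)
    rw [hasGradientAt_iff_hasFDerivAt]
    convert! h2 using 1
    simp [gradient, smul_smul]
  have hgrad_le : ∀ x, {x | r ≤ w x}.indicator (fun x ↦ ‖gradient η x‖ₑ ^ 2) x ≤
      A * s.indicator (fun x ↦ ‖gradient φ x‖ₑ ^ 2) x := by
    intro x
    by_cases hx : r ≤ w x
    · rw [indicator_of_mem (show x ∈ {x | r ≤ w x} from hx), (hgrad x).gradient, enorm_smul, mul_pow]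
      by_cases hx2 : φ x ≤ r / 2
      · rw [indicator_of_mem (hmem x hx hx2)]
        rw [hA, ← ofReal_norm (_ * _)]
        gcongr
        rw [norm_mul, mul_comm, Real.norm_of_nonneg (by positivity : 0 ≤ 4 / r)]
        gcongr
        exact hL _
      · push Not at hx2
        have h1 : 1 < 4 / r * φ x - 1 := by
          have : 4 / r * (r / 2) < 4 / r * φ x := by gcongr
          have h2 : 4 / r * (r / 2) = 2 := by field_simp; norm_num
          linarith
        simp [Real.smoothTransition.deriv_of_one_lt h1]
    · simp [hx]
  refine ⟨η, ⟨?_, ?_, ?_⟩, fun x ↦ ⟨Real.smoothTransition.nonneg _, Real.smoothTransition.le_one _⟩,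
    ?_, ?_⟩
  · exact Real.smoothTransition.contDiff.comp ((contDiff_const.mul hφ.contDiff).sub contDiff_const)
  · exact HasCompactSupport.of_support_subset_isCompact hφ.hasCompactSupport hη_supp
  · exact (closure_minimal hη_supp (isClosed_tsupport φ)).trans hφ.tsupport_subset
  · calc ∫⁻ x in Ω, {x | r ≤ w x}.indicator (fun x ↦ ‖gradient η x‖ₑ ^ 2) x
        ≤ ∫⁻ x, A * s.indicator (fun x ↦ ‖gradient φ x‖ₑ ^ 2) x ∂μ := lintegral_mono hgrad_le
      _ = A * ∫⁻ x in s, ‖gradient φ x‖ₑ ^ 2 ∂μ := by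
          rw [lintegral_const_mul' _ _ hA_top, lintegral_indicator₀ hs_meas]
      _ ≤ A * ∫⁻ x in s, (2 * ‖G x‖ₑ ^ 2 + 2 * ‖G x - gradient φ x‖ₑ ^ 2) ∂μ := by
          gcongr with x
          have h1 := enorm_add_sq_le (G x) (gradient φ x - G x)
          rwa [add_sub_cancel, enorm_sub_rev (gradient φ x)] at h1
      _ = A * (2 * ∫⁻ x in s, ‖G x‖ₑ ^ 2 ∂μ) +
          A * (2 * ∫⁻ x in s, ‖G x - gradient φ x‖ₑ ^ 2 ∂μ) := by
          rw [lintegral_add_left' ((hG2.1.restrict.enorm.pow_const 2).const_mul 2),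
            lintegral_const_mul' _ _ (by simp), lintegral_const_mul' _ _ (by simp), mul_add]
      _ ≤ δ / 2 + δ / 2 := by
          gcongr
          · exact hκG s (hμs.trans_lt hεκ)
          · refine le_trans ?_ hεA.le
            gcongr
            exact (setLIntegral_le_lintegral s _).trans hφG2
      _ = δ := ENNReal.add_halves δ
  · refine (measure_mono fun x hx ↦ ?_).trans (hμs.trans hεδ.le)
    refine hmem x hx.1 (le_of_not_gt fun h ↦ hx.2 (hη_one x h.le))

/-! ### The energy estimate for `log u`. -/

theorem hasDerivAt_energy_weight {ε Λ s : ℝ} (hs : s ≠ 0) :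
    HasDerivAt (fun s ↦ Real.smoothTransition (s / ε - 1) * Real.exp (Λ * s) / s)
      ((Λ - 1 / s) * (Real.smoothTransition (s / ε - 1) * Real.exp (Λ * s) / s) +
        deriv Real.smoothTransition (s / ε - 1) / ε * Real.exp (Λ * s) / s) s := by
  have h1 : HasDerivAt (fun s ↦ Real.smoothTransition (s / ε - 1))
      (deriv Real.smoothTransition (s / ε - 1) * (1 / ε)) s :=
    HasDerivAt.comp (h := fun s ↦ s / ε - 1) s
      (Real.smoothTransition.differentiable (s / ε - 1)).hasDerivAt
      (((hasDerivAt_id s).div_const ε).sub_const 1)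
  have h2 : HasDerivAt (fun s ↦ Real.exp (Λ * s)) (Real.exp (Λ * s) * (Λ * 1)) s :=
    ((hasDerivAt_id s).const_mul Λ).exp
  convert! (h1.mul h2).div (hasDerivAt_id s) hs using 1
  simp only [id, Pi.mul_apply]
  field_simp
  ring

theorem IsTestFunction.mul_self {N : ℕ} {k : ℕ∞} {Ω : Set (Euc N)} {η : Euc N → ℝ}
    (hη : IsTestFunction k Ω η) : IsTestFunction k Ω fun x ↦ η x * η x :=
  ⟨hη.contDiff.mul hη.contDiff, hη.hasCompactSupport.mul_left,
    (tsupport_mul_subset_left (f := η) (g := η)).trans hη.tsupport_subset⟩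

theorem gradient_mul_self {N : ℕ} {η : Euc N → ℝ} {x : Euc N} (hη : DifferentiableAt ℝ η x) :
    gradient (fun x ↦ η x * η x) x = (2 * η x) • gradient η x := by
  have h := hη.hasFDerivAt.mul hη.hasFDerivAt
  have h1 : fderiv ℝ (fun x ↦ η x * η x) x = (2 * η x) • fderiv ℝ η x := by
    rw [show (fun x ↦ η x * η x) = η * η from rfl, h.fderiv, two_mul, add_smul]
  simp [gradient, h1]

section

variable {N : ℕ} {Ω : Set (Euc N)} {u : Euc N → ℝ} {G : Euc N → Euc N} {M : ℝ}

/-- If `u < a = min c s₀`, the point is outside `ω` and `u < s₀`, so `u g ≥ τ` applies. Otherwise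
`u` lies in `[a, M]`, where `g` is bounded and `τ / u ≤ τ / a`. -/
theorem exists_absorbing_constant {g : Euc N → ℝ → ℝ} (hg₀ : LocallyControlled Ω g) {τ : ℝ}
    (hτ : 0 ≤ τ) (hgτ : LargeNearBoundary Ω g τ)
    (hM : ∀ᵐ x ∂(volume.restrict Ω), u x ≤ M) (hu_pos : ∀ᵐ x ∂(volume.restrict Ω), 0 < u x)
    (hpos : ∀ ω, CompactlyContained ω Ω → ∃ c : ℝ, 0 < c ∧ ∀ᵐ x ∂(volume.restrict ω), c ≤ u x) :
    ∃ Λ, 0 ≤ Λ ∧ ∀ᵐ x ∂(volume.restrict Ω), τ / u x ≤ Λ + g x (u x) := by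
  obtain ⟨ω, hω, s₀, hs₀, hlarge⟩ := hgτ
  obtain ⟨g₀, hg₀_cont, hg₀_le⟩ := hg₀
  obtain ⟨c, hc, hcu⟩ := hpos _ (compactlyContained_of_isCompact hω.1 hω.2)
  set a := min c s₀ with ha
  have ha0 : 0 < a := lt_min hc hs₀.1
  obtain ⟨Γ, hΓ⟩ := (isCompact_Icc (a := a) (b := M)).exists_bound_of_continuousOn
    (hg₀_cont.mono fun s hs ↦ ha0.trans_le hs.1)
  refine ⟨|Γ| + τ / a, by positivity, ?_⟩
  filter_upwards [hlarge, hg₀_le, hM, hu_pos,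
    ae_restrict_of_ae ((ae_restrict_iff' isClosed_closure.measurableSet).1 hcu)]
    with x h1 h2 h3 h4 h5
  rcases lt_or_ge (u x) a with hua | hua
  · have hx : x ∉ ω := fun hx ↦
      absurd (h5 (subset_closure hx)) (not_le.2 (hua.trans_le (min_le_left _ _)))
    have h6 := h1 hx (u x) ⟨h4, hua.trans_le (min_le_right _ _)⟩
    have h7 : τ / u x ≤ g x (u x) := by rwa [div_le_iff₀ h4, mul_comm]
    have : 0 ≤ |Γ| + τ / a := by positivity
    linarith
  · have h6 : |g x (u x)| ≤ |Γ| :=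
      (h2 _ h4).trans ((le_abs_self _).trans ((hΓ _ ⟨hua, h3⟩).trans (le_abs_self _)))
    have h7 : τ / u x ≤ τ / a := by gcongr
    linarith [neg_abs_le (g x (u x))]

/-- The first three terms in the bracket on the right form the integrand of the equation tested with
`F(u) η²`, which integrates to 0; the last ones are the error. Here `p`, `z`, `q` stand for `∇u`,
`∇η` and the truncation in `u`. Squaring `η` leaves a factor `η` in the cross term, so Young's
inequality absorbs it. -/
theorem energy_pointwise {E : Type*} [NormedAddCommGroup E] [InnerProductSpace ℝ E]
    {σ s q e A F F' γ η₀ h₀ : ℝ} {p z : E} (hσ : 0 < σ)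
    (hs : 0 < s) (hq : 0 ≤ q) (he : 1 ≤ e) (heA : e ≤ A) (hq1 : q ≤ 1) (hF : F = q * e / s)
    (hF' : σ / s * F ≤ F' + γ * F) (hη0 : 0 ≤ η₀) (hη1 : η₀ ≤ 1) :
    q / s ^ 2 * (η₀ ^ 2 * ‖p‖ ^ 2) ≤ 2 / σ * (inner ℝ p (F • ((2 * η₀) • z) +
      (F' * (η₀ * η₀)) • p) + γ * ‖p‖ ^ 2 * (F * (η₀ * η₀)) - h₀ * (F * (η₀ * η₀)) +
      (2 * A / σ * (q * ‖z‖ ^ 2) + A * (|h₀| / s))) := by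
  have hF0 : 0 ≤ F := by rw [hF]; positivity
  have hA : 0 ≤ A := by linarith
  have hFs : s * F = q * e := by rw [hF]; field_simp
  have hFA : F ≤ A / s := by
    rw [hF]
    gcongr
    nlinarith
  have h1 : inner ℝ p (F • ((2 * η₀) • z) + (F' * (η₀ * η₀)) • p) =
      2 * F * η₀ * inner ℝ p z + F' * (η₀ * η₀) * ‖p‖ ^ 2 := by
    rw [inner_add_right, inner_smul_right, inner_smul_right, inner_smul_right,
      real_inner_self_eq_norm_sq]
    ring
  have h2 : h₀ * (F * (η₀ * η₀)) ≤ A * (|h₀| / s) := by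
    have h3 : F * (η₀ * η₀) ≤ A / s * 1 := by
      gcongr
      nlinarith
    calc h₀ * (F * (η₀ * η₀)) ≤ |h₀| * (F * (η₀ * η₀)) := by
          gcongr
          exact le_abs_self h₀
      _ ≤ |h₀| * (A / s * 1) := by gcongr
      _ = _ := by ring
  have h3 : -(σ / 2 * (F / s * (η₀ ^ 2 * ‖p‖ ^ 2))) - 2 * A / σ * (q * ‖z‖ ^ 2) ≤
      2 * F * η₀ * inner ℝ p z := by
    have h4 : -(‖p‖ * ‖z‖) ≤ inner ℝ p z := neg_le_of_abs_le (abs_real_inner_le_norm p z)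
    have h5 : 2 * F * η₀ * -(‖p‖ * ‖z‖) ≤ 2 * F * η₀ * inner ℝ p z := by gcongr
    -- This square is weighted so that the cross term uses exactly half of the coercive term `σ F /
    -- s`, leaving the other half for the conclusion.
    have h6 : 0 ≤ F / (2 * σ * s) * (σ * (η₀ * ‖p‖) - 2 * s * ‖z‖) ^ 2 := by positivity
    have h7 : F / (2 * σ * s) * (σ * (η₀ * ‖p‖) - 2 * s * ‖z‖) ^ 2 =
        σ / 2 * (F / s * (η₀ ^ 2 * ‖p‖ ^ 2)) - 2 * F * η₀ * (‖p‖ * ‖z‖) +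
          2 / σ * (s * F) * ‖z‖ ^ 2 := by
      field_simp
      ring
    have h8 : 2 / σ * (s * F) * ‖z‖ ^ 2 ≤ 2 / σ * (q * A) * ‖z‖ ^ 2 := by
      rw [hFs]
      gcongr
    have h9 : 2 / σ * (q * A) * ‖z‖ ^ 2 = 2 * A / σ * (q * ‖z‖ ^ 2) := by ring
    linarith
  have h4 : σ / s * F * (η₀ ^ 2 * ‖p‖ ^ 2) ≤ (F' + γ * F) * (η₀ ^ 2 * ‖p‖ ^ 2) := by gcongr
  have h5 : q / s ^ 2 ≤ F / s := by
    rw [hF, div_div, ← sq]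
    gcongr
    nlinarith
  calc q / s ^ 2 * (η₀ ^ 2 * ‖p‖ ^ 2) ≤ F / s * (η₀ ^ 2 * ‖p‖ ^ 2) := by gcongr
    _ = 2 / σ * (σ / 2 * (F / s * (η₀ ^ 2 * ‖p‖ ^ 2))) := by field_simp
    _ ≤ _ := by
      refine mul_le_mul_of_nonneg_left ?_ (by positivity)
      rw [h1]
      have h6 : σ / s * F * (η₀ ^ 2 * ‖p‖ ^ 2) = 2 * (σ / 2 * (F / s * (η₀ ^ 2 * ‖p‖ ^ 2))) := by
        ring
      nlinarith

/-- A bound on the Dirichlet energy of `log u` where `u ≥ 2 ε`, uniform in `ε`. -/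
theorem exists_energy_bound (hΩ : IsOpen Ω) {h : Euc N → ℝ} (hh : IntegrableOn h Ω)
    {g : Euc N → ℝ → ℝ} (hg : IsCaratheodory Ω g) (hg₀ : LocallyControlled Ω g) {τ : ℝ}
    (hτ : 1 < τ) (hgτ : LargeNearBoundary Ω g τ) (hG : MemH1loc Ω u G)
    (hu : AEMeasurable u (volume.restrict Ω)) (hM : ∀ᵐ x ∂(volume.restrict Ω), u x ≤ M)
    (hpos : ∀ ω, CompactlyContained ω Ω → ∃ c : ℝ, 0 < c ∧ ∀ᵐ x ∂(volume.restrict ω), c ≤ u x)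
    (heq : ∀ φ : Euc N → ℝ, IsTestFunction 1 Ω φ →
      (∫ x in Ω, inner ℝ (G x) (gradient φ x)) + ∫ x in Ω, g x (u x) * ‖G x‖ ^ 2 * φ x
        = ∫ x in Ω, h x * φ x)
    (hhu : IntegrableOn (fun x ↦ |h x| / u x) Ω) :
    ∃ K : ENNReal, K ≠ ⊤ ∧ ∀ ε : ℝ, 0 < ε → ∀ η : Euc N → ℝ, IsTestFunction ⊤ Ω η →
      (∀ x, 0 ≤ η x ∧ η x ≤ 1) →
      ∫⁻ x in Ω, {x | ε ≤ u x}.indicator (fun x ↦ ‖gradient η x‖ₑ ^ 2) x ≤ 1 →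
      ∫⁻ x in Ω, ENNReal.ofReal (Real.smoothTransition (u x / ε - 1) / u x ^ 2 *
        (η x ^ 2 * ‖G x‖ ^ 2)) ≤ K := by
  have hu_pos := ae_pos_of_locally hΩ hpos
  obtain ⟨Λ, hΛ, hΛg⟩ := exists_absorbing_constant hg₀ (by linarith) hgτ hM hu_pos hpos
  set σ := τ - 1 with hσdef
  have hσ : 0 < σ := by rw [hσdef]; linarith
  set A := Real.exp (Λ * M) with hA
  -- The factor 1 bounds the integral of the truncation times `‖∇η‖²`: the truncation is at most 1
  -- and vanishes where `u ≤ ε`.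
  refine ⟨ENNReal.ofReal (2 / σ * (2 * A / σ * 1 + A * ∫ x in Ω, |h x| / u x)),
    ENNReal.ofReal_ne_top, ?_⟩
  intro ε hε η hη hη01 hη_grad
  set F : ℝ → ℝ := fun s ↦ Real.smoothTransition (s / ε - 1) * Real.exp (Λ * s) / s with hF
  have hF_smooth : ContDiffOn ℝ 1 F (Ioi 0) := by
    refine ContDiff.contDiffOn ?_ |>.div contDiffOn_id fun s hs ↦ ne_of_gt hs
    exact (Real.smoothTransition.contDiff (n := 1).comp ((contDiff_id.div_const ε).sub
      contDiff_const)).mul (contDiff_const.mul contDiff_id).exp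
  obtain ⟨int1, int2, int3, hweak⟩ :=
    weak_formulation_comp_mul hΩ hh hg hg₀ hG hu hM hpos heq hF_smooth hη.mul_self
  have hη_grad2 := hη.memLp_gradient (by simp)
  have hq_meas : AEStronglyMeasurable (fun x ↦ Real.smoothTransition (u x / ε - 1))
      (volume.restrict Ω) :=
    (Real.smoothTransition.continuous.measurable.comp_aemeasurable
      ((hu.div_const ε).sub_const 1)).aestronglyMeasurable
  have int4 : IntegrableOn (fun x ↦ Real.smoothTransition (u x / ε - 1) * ‖gradient η x‖ ^ 2) Ω :=
    (hη_grad2.integrable_norm_pow (by norm_num)).bdd_mul (c := 1) hq_meas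
      (Eventually.of_forall fun x ↦ by
        rw [Real.norm_of_nonneg (Real.smoothTransition.nonneg _)]
        exact Real.smoothTransition.le_one _)
  have hle4 : ∫ x in Ω, Real.smoothTransition (u x / ε - 1) * ‖gradient η x‖ ^ 2 ≤ 1 := by
    rw [integral_eq_lintegral_of_nonneg_ae (Eventually.of_forall fun x ↦
      mul_nonneg (Real.smoothTransition.nonneg _) (by positivity)) int4.1]
    refine ENNReal.toReal_le_of_le_ofReal one_pos.le ?_
    rw [ENNReal.ofReal_one]
    refine le_trans (lintegral_mono fun x ↦ ?_) hη_grad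
    by_cases hx : ε ≤ u x
    · rw [indicator_of_mem (show x ∈ {x | ε ≤ u x} from hx), ← ofReal_norm,
        ← ENNReal.ofReal_pow (norm_nonneg _)]
      exact ENNReal.ofReal_le_ofReal
        (mul_le_of_le_one_left (by positivity) (Real.smoothTransition.le_one _))
    · have : u x / ε - 1 ≤ 0 := by
        rw [sub_nonpos, div_le_one hε]
        exact (not_le.1 hx).le
      simp [Real.smoothTransition.zero_of_nonpos this]
  set J : Euc N → ℝ := fun x ↦ inner ℝ (G x) (F (u x) • gradient (fun x ↦ η x * η x) x +
    (deriv F (u x) * (η x * η x)) • G x) + g x (u x) * ‖G x‖ ^ 2 * (F (u x) * (η x * η x)) -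
    h x * (F (u x) * (η x * η x)) with hJ
  have intJ : IntegrableOn J Ω := (int1.add int2).sub int3
  have hJ0 : ∫ x in Ω, J x = 0 := by
    have h1 := integral_sub (int1.add int2) int3
    have h2 := integral_add int1 int2
    simp only [Pi.add_apply] at h1
    rw [hJ, h1, h2, hweak, sub_self]
  set Y : Euc N → ℝ := fun x ↦ 2 * A / σ * (Real.smoothTransition (u x / ε - 1) *
    ‖gradient η x‖ ^ 2) + A * (|h x| / u x) with hY
  have intY : IntegrableOn Y Ω := (int4.const_mul _).add (hhu.const_mul _)
  have hpt : ∀ᵐ x ∂(volume.restrict Ω), Real.smoothTransition (u x / ε - 1) / u x ^ 2 *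
      (η x ^ 2 * ‖G x‖ ^ 2) ≤ 2 / σ * (J x + Y x) := by
    filter_upwards [hu_pos, hM, hΛg] with x h1 h2 h3
    have hgrad := gradient_mul_self ((hη.contDiff.differentiable (by simp)) x)
    simp only [hJ, hY, hgrad]
    refine energy_pointwise hσ h1 (Real.smoothTransition.nonneg _)
      (e := Real.exp (Λ * u x)) (Real.one_le_exp (by positivity))
      (Real.exp_le_exp.2 (by gcongr)) (Real.smoothTransition.le_one _) rfl ?_ (hη01 x).1 (hη01 x).2
    have hF0 : 0 ≤ F (u x) :=
      div_nonneg (mul_nonneg (Real.smoothTransition.nonneg _) (Real.exp_pos _).le) h1.le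
    rw [(hasDerivAt_energy_weight (ε := ε) (Λ := Λ) h1.ne').deriv]
    -- The derivative of the truncation blows up as `ε → 0`, but it has the favourable sign and is
    -- simply dropped; hence the uniformity in `ε`.
    have h4 : 0 ≤ deriv Real.smoothTransition (u x / ε - 1) / ε * Real.exp (Λ * u x) / u x := by
      have := Real.smoothTransition.monotone.deriv_nonneg (x := u x / ε - 1)
      positivity
    have h5 : σ / u x * F (u x) ≤ (Λ - 1 / u x + g x (u x)) * F (u x) := by
      gcongr
      rw [hσdef, sub_div]
      linarith
    have h6 : F (u x) = Real.smoothTransition (u x / ε - 1) * Real.exp (Λ * u x) / u x := rfl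
    rw [← h6]
    linarith
  calc _ ≤ ∫⁻ x in Ω, ENNReal.ofReal (2 / σ * (J x + Y x)) := by
        refine lintegral_mono_ae ?_
        filter_upwards [hpt] with x hx using ENNReal.ofReal_le_ofReal hx
    _ = ENNReal.ofReal (∫ x in Ω, 2 / σ * (J x + Y x)) := by
        refine (ofReal_integral_eq_lintegral_ofReal ((intJ.add intY).const_mul _) ?_).symm
        filter_upwards [hpt] with x hx
        refine le_trans ?_ hx
        have := Real.smoothTransition.nonneg (u x / ε - 1)
        simp only [Pi.zero_apply]
        positivity
    _ ≤ _ := by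
        refine ENNReal.ofReal_le_ofReal ?_
        rw [integral_const_mul, integral_add intJ intY, hJ0, zero_add]
        simp only [hY]
        rw [integral_add (int4.const_mul _) (hhu.const_mul _), integral_const_mul,
          integral_const_mul]
        gcongr

end

/-! ### The logarithmic cutoff and the contradiction. -/

theorem hasDerivAt_log_cutoff {m s : ℝ} (hs : s ≠ 0) :
    HasDerivAt (fun s ↦ Real.smoothTransition (Real.log s / m + 2))
      (deriv Real.smoothTransition (Real.log s / m + 2) * (1 / s / m)) s := by
  have h1 : HasDerivAt (fun s ↦ Real.log s / m + 2) (1 / s / m) s := by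
    simpa [one_div] using ((Real.hasDerivAt_log hs).div_const m).add_const 2
  exact HasDerivAt.comp (h := fun s ↦ Real.log s / m + 2) s
    (Real.smoothTransition.differentiable _).hasDerivAt h1

theorem contDiffOn_log_cutoff (m : ℝ) :
    ContDiffOn ℝ 1 (fun s ↦ Real.smoothTransition (Real.log s / m + 2)) (Ioi 0) :=
  (Real.smoothTransition.contDiff (n := 1)).comp_contDiffOn
    (((Real.contDiffOn_log.mono fun _ hs ↦ (ne_of_gt hs : _)).div_const m).add contDiffOn_const)

theorem log_cutoff_grad_le {E : Type*} [NormedAddCommGroup E] [NormedSpace ℝ E] {L m s η : ℝ}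
    (hL : ∀ x, |deriv Real.smoothTransition x| ≤ L) (hm : 0 < m) (hs : 0 < s)
    (p z : E) :
    ‖Real.smoothTransition (Real.log s / m + 2) • z +
      (deriv Real.smoothTransition (Real.log s / m + 2) * (1 / s / m) * η) • p‖ₑ ^ 2 ≤
    2 * {t : ℝ | Real.exp (-(2 * m)) / 2 ≤ t}.indicator (fun _ ↦ ‖z‖ₑ ^ 2) s +
      2 * (ENNReal.ofReal ((L / m) ^ 2) * ENNReal.ofReal (Real.smoothTransition
        (s / (Real.exp (-(2 * m)) / 2) - 1) / s ^ 2 * (η ^ 2 * ‖p‖ ^ 2))) := by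
  refine (enorm_add_sq_le _ _).trans ?_
  have hexp := Real.exp_pos (-(2 * m))
  -- Below `e^{-2m}` the logarithmic cutoff and its derivative vanish. Above it, the energy
  -- truncation at level `ε = e^{-2m}/2` already equals 1, because `s ≥ 2ε`.
  rcases lt_or_ge s (Real.exp (-(2 * m))) with hlt | hge
  · have h1 : Real.log s / m + 2 < 0 := by
      have h2 : Real.log s < -(2 * m) := by rwa [Real.log_lt_iff_lt_exp hs]
      have h3 : Real.log s / m < -2 := by
        rw [div_lt_iff₀ hm]
        linarith
      linarith
    simp [Real.smoothTransition.zero_of_nonpos h1.le, Real.smoothTransition.deriv_of_neg h1]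
  · rw [indicator_of_mem (show s ∈ {t : ℝ | Real.exp (-(2 * m)) / 2 ≤ t} by
      simp only [mem_ofPred_eq]; linarith)]
    gcongr
    · rw [enorm_smul, Real.enorm_of_nonneg (Real.smoothTransition.nonneg _)]
      exact mul_le_of_le_one_left zero_le
        (ENNReal.ofReal_le_one.2 (Real.smoothTransition.le_one _))
    · have h1 : Real.smoothTransition (s / (Real.exp (-(2 * m)) / 2) - 1) = 1 := by
        refine Real.smoothTransition.one_of_one_le ?_
        rw [le_sub_iff_add_le, le_div_iff₀ (by positivity)]
        linarith
      rw [h1, ← ENNReal.ofReal_mul (by positivity), ← ofReal_norm,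
        ← ENNReal.ofReal_pow (norm_nonneg _)]
      refine ENNReal.ofReal_le_ofReal ?_
      rw [norm_smul, norm_mul, norm_mul, Real.norm_of_nonneg (by positivity : 0 ≤ 1 / s / m),
        mul_pow, mul_pow, mul_pow, Real.norm_eq_abs, Real.norm_eq_abs, sq_abs η]
      have h2 : |deriv Real.smoothTransition (Real.log s / m + 2)| ^ 2 ≤ L ^ 2 := by
        gcongr
        exact hL _
      calc |deriv Real.smoothTransition (Real.log s / m + 2)| ^ 2 * (1 / s / m) ^ 2 * η ^ 2 *
            ‖p‖ ^ 2 ≤ L ^ 2 * (1 / s / m) ^ 2 * η ^ 2 * ‖p‖ ^ 2 := by gcongr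
        _ = (L / m) ^ 2 * (1 / s ^ 2 * (η ^ 2 * ‖p‖ ^ 2)) := by
          field_simp

/-- On `B` the logarithmic cutoff is 1, since `u ≥ c ≥ e^{-m}`. So `B ∩ {η = 1}` is measured by the
left side of the Poincaré inequality, and the rest of `B` lies in the exceptional set of measure at
most `δ`. -/
theorem measure_ball_le_of_energy_bound {N : ℕ} {Ω B : Set (Euc N)} {u : Euc N → ℝ}
    {G : Euc N → Euc N} {c m L : ℝ} {C K δ : ENNReal} {η : Euc N → ℝ}
    (hB : MeasurableSet B) (hBΩ : B ⊆ Ω) (hη_cont : Continuous η)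
    (hu_pos : ∀ᵐ x ∂(volume.restrict Ω), 0 < u x)
    (hcB : ∀ᵐ x ∂(volume.restrict B), c ≤ u x)
    (hm : 0 < m) (hmc : Real.exp (-m) ≤ c)
    (hL : ∀ x, |deriv Real.smoothTransition x| ≤ L)
    (hC : ∫⁻ x in Ω, ‖Real.smoothTransition (Real.log (u x) / m + 2) * η x‖ₑ ^ 2 ≤
      C * ∫⁻ x in Ω, ‖Real.smoothTransition (Real.log (u x) / m + 2) • gradient η x +
        (deriv (fun s ↦ Real.smoothTransition (Real.log s / m + 2)) (u x) * η x) • G x‖ₑ ^ 2)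
    (hη1 : ∫⁻ x in Ω, {x | Real.exp (-(2 * m)) / 2 ≤ u x}.indicator
      (fun x ↦ ‖gradient η x‖ₑ ^ 2) x ≤ δ)
    (hη2 : volume.restrict Ω {x | Real.exp (-(2 * m)) / 2 ≤ u x ∧ η x ≠ 1} ≤ δ)
    (hmeas : AEMeasurable (fun x ↦ {x | Real.exp (-(2 * m)) / 2 ≤ u x}.indicator
      (fun x ↦ ‖gradient η x‖ₑ ^ 2) x) (volume.restrict Ω))
    (hK : ∫⁻ x in Ω, ENNReal.ofReal (Real.smoothTransition (u x / (Real.exp (-(2 * m)) / 2) - 1) /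
      u x ^ 2 * (η x ^ 2 * ‖G x‖ ^ 2)) ≤ K) :
    volume B ≤ C * (2 * δ + 2 * (ENNReal.ofReal ((L / m) ^ 2) * K)) + δ := by
  have hS : MeasurableSet {x | η x = 1} := hη_cont.measurable (measurableSet_singleton 1)
  have h1 : volume (B ∩ {x | η x = 1}) ≤
      ∫⁻ x in Ω, ‖Real.smoothTransition (Real.log (u x) / m + 2) * η x‖ₑ ^ 2 := by
    calc volume (B ∩ {x | η x = 1}) = ∫⁻ _ in B ∩ {x | η x = 1}, 1 := by simp
      _ ≤ ∫⁻ x in B ∩ {x | η x = 1},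
          ‖Real.smoothTransition (Real.log (u x) / m + 2) * η x‖ₑ ^ 2 := by
        refine lintegral_mono_ae ?_
        filter_upwards [ae_restrict_mem (hB.inter hS),
          ae_restrict_of_ae_restrict_of_subset inter_subset_left hcB] with x hx hxc
        have h2 : -m ≤ Real.log (u x) := by
          rw [Real.le_log_iff_exp_le ((Real.exp_pos _).trans_le (hmc.trans hxc))]
          exact hmc.trans hxc
        have h3 : -1 ≤ Real.log (u x) / m := by
          rw [le_div_iff₀ hm]
          linarith
        rw [Real.smoothTransition.one_of_one_le (by linarith), show η x = 1 from hx.2]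
        simp
      _ ≤ _ := lintegral_mono_set (inter_subset_left.trans hBΩ)
  have h2 : volume (B \ {x | η x = 1}) ≤ δ := by
    refine le_trans ?_ hη2
    rw [← Measure.restrict_eq_self volume (sdiff_subset.trans hBΩ : B \ {x | η x = 1} ⊆ Ω)]
    refine measure_mono_ae ?_
    have h3 := ae_restrict_of_ae (s := Ω) ((ae_restrict_iff' hB).1 hcB)
    filter_upwards [h3] with x hx hxB
    refine ⟨le_trans ?_ (hx hxB.1), hxB.2⟩
    have h4 : Real.exp (-(2 * m)) ≤ Real.exp (-m) := Real.exp_le_exp.2 (by linarith)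
    have := Real.exp_pos (-(2 * m))
    linarith
  have h3 : ∫⁻ x in Ω, ‖Real.smoothTransition (Real.log (u x) / m + 2) • gradient η x +
      (deriv (fun s ↦ Real.smoothTransition (Real.log s / m + 2)) (u x) * η x) • G x‖ₑ ^ 2 ≤
      2 * δ + 2 * (ENNReal.ofReal ((L / m) ^ 2) * K) := by
    calc _ ≤ ∫⁻ x in Ω, (2 * {x | Real.exp (-(2 * m)) / 2 ≤ u x}.indicator
          (fun x ↦ ‖gradient η x‖ₑ ^ 2) x + 2 * (ENNReal.ofReal ((L / m) ^ 2) *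
          ENNReal.ofReal (Real.smoothTransition (u x / (Real.exp (-(2 * m)) / 2) - 1) /
            u x ^ 2 * (η x ^ 2 * ‖G x‖ ^ 2)))) := by
          refine lintegral_mono_ae ?_
          filter_upwards [hu_pos] with x hx
          rw [(hasDerivAt_log_cutoff hx.ne').deriv]
          exact log_cutoff_grad_le hL hm hx _ _
      _ ≤ _ := by
          rw [lintegral_add_left' (hmeas.const_mul 2), lintegral_const_mul' _ _ (by simp),
            lintegral_const_mul' _ _ (by simp), lintegral_const_mul' _ _ ENNReal.ofReal_ne_top]
          gcongr
  calc volume B = volume (B ∩ {x | η x = 1}) + volume (B \ {x | η x = 1}) :=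
        (measure_inter_add_sdiff B hS).symm
    _ ≤ _ := by
        gcongr
        exact h1.trans (hC.trans (by gcongr))

theorem mainTheorem11 (N : ℕ) (hN : 3 ≤ N) (Ω : Set (Euc N)) (hΩ_open : IsOpen Ω)
    (hΩ_conn : IsConnected Ω) (hΩ_bdd : Bornology.IsBounded Ω)
    (h : Euc N → ℝ) (hh : IntegrableOn h Ω)
    (g : Euc N → ℝ → ℝ) (hg : IsCaratheodory Ω g) (hg₀ : LocallyControlled Ω g)
    (τ : ℝ) (hτ : 1 < τ) (hgτ : LargeNearBoundary Ω g τ)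
    (u : Euc N → ℝ) (hu : IsSolution Ω g h u) :
    ∫⁻ x in Ω, ENNReal.ofReal (|h x| / u x) = ⊤ := by
  obtain ⟨hu_top, hpos, ⟨γ, hγ, hγu⟩, G, hG, heq⟩ := hu
  by_contra hfin
  have hum : AEMeasurable u (volume.restrict Ω) := hu_top.1.aemeasurable
  have hu_pos := ae_pos_of_locally hΩ_open hpos
  obtain ⟨M, hM⟩ : ∃ M, ∀ᵐ x ∂(volume.restrict Ω), u x ≤ M := by
    refine ⟨(eLpNormEssSup u (volume.restrict Ω)).toReal, ?_⟩
    have h1 := hu_top.2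
    rw [eLpNorm_exponent_top] at h1
    filter_upwards [ae_le_eLpNormEssSup (f := u) (μ := volume.restrict Ω)] with x hx
    refine (le_abs_self _).trans ?_
    rw [← Real.norm_eq_abs, ← toReal_enorm]
    exact ENNReal.toReal_mono h1.ne hx
  have hhu : IntegrableOn (fun x ↦ |h x| / u x) Ω := by
    refine (lintegral_ofReal_ne_top_iff_integrable
      (hh.aemeasurable.norm.div hum).aestronglyMeasurable ?_).1 hfin
    filter_upwards [hu_pos] with x hx
    exact div_nonneg (abs_nonneg _) hx.le
  obtain ⟨K, hK, henergy⟩ := exists_energy_bound hΩ_open hh hg hg₀ hτ hgτ hG hum hM hpos heq hhu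
  obtain ⟨C, hC, hpoincare⟩ := exists_poincare_comp_mul hN hΩ_open hΩ_bdd
  obtain ⟨L, -, hL⟩ := Real.smoothTransition.exists_abs_deriv_le
  obtain ⟨x₀, hx₀⟩ := hΩ_conn.nonempty
  obtain ⟨r, hr, hrΩ⟩ := Metric.nhds_basis_closedBall.mem_iff.1 (hΩ_open.mem_nhds hx₀)
  set B := Metric.closedBall x₀ r
  have hBm : MeasurableSet B := Metric.isClosed_closedBall.measurableSet
  have hB0 : 0 < volume B := Metric.measure_closedBall_pos _ _ hr
  obtain ⟨c, hc, hcB⟩ := hpos B (compactlyContained_of_isCompact (isCompact_closedBall _ _) hrΩ)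
  -- `C`, `K` and `L` are fixed before `m`, so the right side tends to 0; `1 ≤ m` ensures `δ = 1/m ≤
  -- 1`, as the energy bound demands.
  have hbound : ∀ m : ℝ, 1 ≤ m → Real.exp (-m) ≤ c → volume B ≤
      C * (2 * ENNReal.ofReal (1 / m) + 2 * (ENNReal.ofReal ((L / m) ^ 2) * K)) +
        ENNReal.ofReal (1 / m) := by
    intro m hm hmc
    have hm0 : 0 < m := by linarith
    set ε := Real.exp (-(2 * m)) / 2 with hε
    have hε0 : 0 < ε := by positivity
    -- It is `u^γ`, not `u`, that is known to be in `H¹₀`; the level `ε^γ` for `u^γ` corresponds to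
    -- the level `ε` for `u`.
    obtain ⟨η, hη, hη01, hη1, hη2⟩ := exists_cutoff hγu (Real.rpow_pos_of_pos hε0 γ)
      (δ := ENNReal.ofReal (1 / m)) (ENNReal.ofReal_pos.2 (by positivity))
    have hiff : ∀ᵐ x ∂(volume.restrict Ω), (ε ^ γ ≤ u x ^ γ ↔ ε ≤ u x) := by
      filter_upwards [hu_pos] with x hx using Real.rpow_le_rpow_iff hε0.le hx.le hγ
    have hη1' : ∫⁻ x in Ω, {x | ε ≤ u x}.indicator (fun x ↦ ‖gradient η x‖ₑ ^ 2) x ≤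
        ENNReal.ofReal (1 / m) := by
      refine le_trans (le_of_eq (lintegral_congr_ae ?_)) hη1
      filter_upwards [hiff] with x hx
      simp only [indicator, mem_ofPred_eq, hx]
    have hη2' : volume.restrict Ω {x | ε ≤ u x ∧ η x ≠ 1} ≤ ENNReal.ofReal (1 / m) := by
      refine le_trans (measure_mono_ae ?_) hη2
      filter_upwards [hiff] with x hx hx'
      exact ⟨hx.2 hx'.1, hx'.2⟩
    have hmeas : AEMeasurable (fun x ↦ {x | ε ≤ u x}.indicator (fun x ↦ ‖gradient η x‖ₑ ^ 2) x)
        (volume.restrict Ω) :=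
      (((hη.continuous_gradient (by simp)).enorm.measurable.pow_const 2).aemeasurable).indicator₀
        (nullMeasurableSet_le aemeasurable_const hum)
    have hδ1 : ENNReal.ofReal (1 / m) ≤ 1 :=
      ENNReal.ofReal_le_one.2 (by rw [div_le_one hm0]; exact hm)
    exact measure_ball_le_of_energy_bound hBm hrΩ hη.contDiff.continuous hu_pos hcB hm0 hmc hL
      (hpoincare hG hum hM hpos (contDiffOn_log_cutoff m) hη) hη1' hη2' hmeas
      (henergy ε hε0 η hη hη01 (hη1'.trans hδ1))
  have hlim : Tendsto (fun m : ℝ ↦ C * (2 * ENNReal.ofReal (1 / m) +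
      2 * (ENNReal.ofReal ((L / m) ^ 2) * K)) + ENNReal.ofReal (1 / m)) atTop (𝓝 0) := by
    have t1 : Tendsto (fun m : ℝ ↦ ENNReal.ofReal (1 / m)) atTop (𝓝 0) := by
      have := ENNReal.tendsto_ofReal (tendsto_const_nhds (x := (1 : ℝ)).div_atTop tendsto_id)
      simpa using this
    have t2 : Tendsto (fun m : ℝ ↦ ENNReal.ofReal ((L / m) ^ 2)) atTop (𝓝 0) := by
      have := ENNReal.tendsto_ofReal
        ((tendsto_const_nhds (x := L).div_atTop (tendsto_id (α := ℝ))).pow 2)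
      simpa using this
    have t3 := (ENNReal.Tendsto.const_mul t1 (Or.inr (by simp : (2 : ENNReal) ≠ ⊤))).add
      (ENNReal.Tendsto.const_mul (ENNReal.Tendsto.mul_const t2 (Or.inr hK))
        (Or.inr (by simp : (2 : ENNReal) ≠ ⊤)))
    simpa using (ENNReal.Tendsto.const_mul t3 (Or.inr hC)).add t1
  have hev : ∀ᶠ m : ℝ in atTop, Real.exp (-m) ≤ c :=
    (Real.tendsto_exp_neg_atTop_nhds_zero.eventually (gt_mem_nhds hc)).mono fun m hm ↦ hm.le
  have hle := ge_of_tendsto hlim (by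
    filter_upwards [hev, eventually_ge_atTop 1] with m h1 h2 using hbound m h2 h1)
  exact hB0.ne' (le_zero_iff.1 hle)
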